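/- Let $(X,d)$ be a geodesic metric space, $o\in X$ a basepoint, and $G$ a countable discrete group acting on $X$ by isometries. For $A\subseteq X$ and $x\in X$ write $d(x,A)=\inf_{a\in A}d(x,a)$ and $\pi_A(x)=\{a\in A: d(x,a)=d(x,A)\}$. For $K>0$, the set $A$ is $K$-contracting if $\pi_A(z)\neq\emptyset$ for all $z\in X$ and $\operatorname{diam}(\pi_A(x)\cup\pi_A(y))\le K$ whenever $d(x,y)\le d(x,A)-K$. An element $g\in G$ is a contracting isometry if, for some $K>0$, the orbit map $n\in\mathbb Z\mapsto g^no$ is a $K$-quasigeodesic (i.e. $\frac1K|i-j|-K\le d(g^io,g^jo)\le K|i-j|+K$ for all $i,j\in\mathbb Z$) whose image is $K$-contracting. Elements $g,h\in G$ are independent if for every $M>0$ the set $\{(n,m)\in\mathbb Z^2: d(g^no,h^mo)<M\}$ is bounded. Let $\mu$ be a probability measure on $G$ which is non-elementary: the semigroup of all products $g_1\cdots g_n$ ($n\ge0$) of elements of $\operatorname{supp}\mu=\{g:\mu(g)\ne0\}$ contains two independent contracting isometries. Let $(g_i)_{i\in\mathbb Z}$ be independent with law $\mu$, and let $w_n=g_1\cdots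 g_n$ for $n\ge0$ be the random walk generated by $\mu$. No moment condition on $\mu$ is assumed. **Theorem (exponential bound from below).** There is a (necessarily unique) constant $\lambda(\mu)\in(0,+\infty]$, the escape rate, such that $\frac1n d(o,w_no)\to\lambda(\mu)$ almost surely as $n\to\infty$. For every real $L$ with $0<L<\lambda(\mu)$ there exists $K>0$ such that for all $n\ge0$ $$\mathbb P\big[d(o,w_no)\le Ln\big]\le K e^{-n/K}.$$ -/

import Mathlib

open MeasureTheory Filter Topology
open scoped ENNReal

/-- A metric space is geodesic if any two points are joined by a geodesic segment, that is, by an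
isometric embedding of the interval `[0, dist x y]` which starts at `x` and ends at `y`. -/
def IsGeodesicSpace (X : Type*) [MetricSpace X] : Prop :=
  ∀ x y : X, ∃ γ : ℝ → X, γ 0 = x ∧ γ (dist x y) = y ∧
    ∀ s ∈ Set.Icc 0 (dist x y), ∀ t ∈ Set.Icc 0 (dist x y), dist (γ s) (γ t) = |s - t|

/-- The closest point projection `π_A(x)`: the set of all points of `A` nearest to `x`. -/
def closestPoints {X : Type*} [MetricSpace X] (A : Set X) (x : X) : Set X :=
  {a ∈ A | dist x a = Metric.infDist x A}

/-- `A` is `K`-contracting: all closest point projections are non-empty, and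
`diam (π_A(x) ∪ π_A(y)) ≤ K` as soon as `d(x, y) ≤ d(x, A) - K`. The bound on the diameter is
written as a bound on all pairwise distances. -/
def IsContractingSet {X : Type*} [MetricSpace X] (K : ℝ) (A : Set X) : Prop :=
  (∀ z : X, (closestPoints A z).Nonempty) ∧
    ∀ x y : X, dist x y ≤ Metric.infDist x A - K →
      ∀ p ∈ closestPoints A x ∪ closestPoints A y,
        ∀ q ∈ closestPoints A x ∪ closestPoints A y, dist p q ≤ K

/-- A bi-infinite sequence of points, seen as a path with domain `ℤ`, is a `K`-quasigeodesic. -/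
def IsQuasigeodesic {X : Type*} [MetricSpace X] (K : ℝ) (γ : ℤ → X) : Prop :=
  ∀ i j : ℤ, |(i : ℝ) - j| / K - K ≤ dist (γ i) (γ j) ∧ dist (γ i) (γ j) ≤ K * |(i : ℝ) - j| + K

/-- A `K`-contracting axis with domain `ℤ`: a `K`-quasigeodesic whose image is `K`-contracting. -/
def IsContractingAxis {X : Type*} [MetricSpace X] (K : ℝ) (γ : ℤ → X) : Prop :=
  IsQuasigeodesic K γ ∧ IsContractingSet K (Set.range γ)

/-- `g` acts as a contracting isometry: for some `K > 0`, the orbit `n ↦ gⁿ o` is a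
`K`-contracting axis. -/
def IsContractingIsometry {X G : Type*} [MetricSpace X] [Group G] [MulAction G X]
    (o : X) (g : G) : Prop :=
  ∃ K : ℝ, 0 < K ∧ IsContractingAxis K (fun n : ℤ => g ^ n • o)

/-- `g` and `h` are independent: the map `(n, m) ↦ d(gⁿ o, hᵐ o)` on `ℤ × ℤ` is proper. -/
def AreIndependent {X G : Type*} [MetricSpace X] [Group G] [MulAction G X]
    (o : X) (g h : G) : Prop :=
  ∀ M : ℝ, 0 < M →
    Bornology.IsBounded {p : ℤ × ℤ | dist (g ^ p.1 • o) (h ^ p.2 • o) < M}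

/-- The set of group elements that are charged by `μ` (the support, for a discrete group). -/
def atomSupport {G : Type*} [MeasurableSpace G] (μ : Measure G) : Set G :=
  {g | μ {g} ≠ 0}

/-- `μ` is non-elementary: the semigroup of all products `g₁ ⋯ gₙ` (`n ≥ 0`) of elements of the
support of `μ` contains two independent contracting isometries. -/
def IsNonElementary {X G : Type*} [MetricSpace X] [Group G] [MulAction G X] [MeasurableSpace G]
    (o : X) (μ : Measure G) : Prop :=
  ∃ g ∈ Submonoid.closure (atomSupport μ), ∃ h ∈ Submonoid.closure (atomSupport μ),
    IsContractingIsometry o g ∧ IsContractingIsometry o h ∧ AreIndependent o g h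

/-- The law `μ^ℤ` of the step path `(gₙ)_{n ∈ ℤ}`: the steps are independent with law `μ`. -/
noncomputable def stepMeasure {G : Type*} [MeasurableSpace G] (μ : Measure G)
    [IsProbabilityMeasure μ] : Measure (ℤ → G) :=
  Measure.infinitePi (fun _ : ℤ => μ)

/-- The position `w_n = g₁ g₂ ⋯ gₙ` of the random walk at time `n ≥ 0` (so `w_0 = 1`). -/
def walk {G : Type*} [Group G] (g : ℤ → G) : ℕ → G
  | 0 => 1
  | n + 1 => walk g n * g ((n : ℤ) + 1)

/-- `ℓ ∈ [0, +∞]` is the escape rate of the random walk generated by `μ`: the sequence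
`d(o, w_n o) / n` converges to `ℓ` almost surely. There is at most one such `ℓ`. -/
def IsEscapeRate {X G : Type*} [MetricSpace X] [Group G] [MulAction G X] [MeasurableSpace G]
    (o : X) (μ : Measure G) [IsProbabilityMeasure μ] (ℓ : ℝ≥0∞) : Prop :=
  ∀ᵐ g ∂(stepMeasure μ),
    Tendsto (fun n : ℕ => ENNReal.ofReal (dist o (walk g n • o) / n)) atTop (𝓝 ℓ)

/-! ### Closest point projections to contracting sets -/

section ContractingGeometry

variable {X : Type*} [MetricSpace X]

/-! The rate is `speed`, the infimum of the mean displacements `E d(o, w_N o) / N`, possibly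
infinite. The strong law applied to independent blocks of `N` steps gives the almost sure upper
bound (`ae_eventually_dist_walk_lt`). The lower bound is Borel–Cantelli applied to the exponential
estimate `IsNonElementary.exists_exp_bound`, so everything rests on that estimate.

Geometry. From two independent contracting elements one builds a finite Schottky family
(`exists_isSchottky`): any group element, used as a gap, is badly aligned with only a proportion `η`
of the letters on either side, and if all letters of `h₀ s₁ h₁ ⋯ sₘ hₘ` are aligned with their gaps,
the word moves `o` by at least the sum of the `1 + d(o, hᵢ o)`, `1 ≤ i ≤ m`. This local-to-global
principle follows from the Behrstock inequality and from the fact that geodesics follow contracting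
axes.

Probability. For a suitable `R`, the law of `w_R` is, up to a remainder of small mass, that of `u s
v` with `s` a uniform Schottky letter independent of the bounded pair `(u, v)`
(`exists_decomposition`). The walk is cut into blocks made of `N` free steps and `R` such steps.
Conditionally on everything but the letters it is a random word, whose gaps contain the free parts.
A newly added letter is aligned except with probability `2η`; then the word backtracks, and the
previous letters are conditioned or revealed until an aligned one is found. Each retained letter
earns a reward, comparable to the displacement of the free part next to it, and backtracking loses
roughly a geometric number of recent rewards. The function `potential` is designed to absorb these
losses: it bounds the expectation of `exp (-t d(o, w o))` by an induction on the number of blocks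
(`IsSchottky.pendingAvg_expDisp_le`).

Outcome. By `IsNonElementary.exists_block_bound`, any `L` with `L (N + R) < (1 - γ) E[reward]`
satisfies the exponential bound, and `R` does not depend on `N`. With `N = 0` and reward `1` this
shows `speed > 0`. With `N` large and the truncated displacement as reward it reaches every `L <
speed`; only truncations are integrated, so no moment is needed. -/

lemma IsContractingSet.mono {K K' : ℝ} {A : Set X} (h : IsContractingSet K A) (hK : K ≤ K') :
    IsContractingSet K' A :=
  ⟨h.1, fun x y hxy p hp q hq => (h.2 x y (by linarith) p hp q hq).trans hK⟩

lemma IsQuasigeodesic.mono {K K' : ℝ} {γ : ℤ → X} (h : IsQuasigeodesic K γ) (h0 : 0 < K)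
    (hK : K ≤ K') : IsQuasigeodesic K' γ := by
  intro i j
  have h1 : |(i : ℝ) - j| / K' ≤ |(i : ℝ) - j| / K := by gcongr
  have h2 : K * |(i : ℝ) - j| ≤ K' * |(i : ℝ) - j| := by gcongr
  exact ⟨by linarith [(h i j).1], by linarith [(h i j).2]⟩

lemma mem_closestPoints_self {A : Set X} {a : X} (ha : a ∈ A) : a ∈ closestPoints A a :=
  ⟨ha, by rw [Metric.infDist_zero_of_mem ha, dist_self]⟩

lemma dist_le_of_mem_closestPoints {A : Set X} {x a p : X} (ha : a ∈ A)
    (hp : p ∈ closestPoints A x) : dist x p ≤ dist x a := by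
  rw [hp.2]; exact Metric.infDist_le_dist_of_mem ha

/-- Along a geodesic which stays `3 K`-far from a `K`-contracting set, the projection moves at
most half as fast as the point. -/
lemma IsContractingSet.dist_proj_le_of_far {K : ℝ} {A : Set X} (hA : IsContractingSet K A)
    {γ : ℝ → X} {ℓ : ℝ}
    (hγ : ∀ s ∈ Set.Icc 0 ℓ, ∀ t ∈ Set.Icc 0 ℓ, dist (γ s) (γ t) = |s - t|) (hK : 0 < K) (n : ℕ) :
    ∀ s t : ℝ, 0 ≤ s → s ≤ t → t ≤ ℓ → (∀ u ∈ Set.Icc s t, 3 * K ≤ Metric.infDist (γ u) A) →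
      t - s ≤ 2 * K * (n + 1) → ∀ p ∈ closestPoints A (γ s), ∀ q ∈ closestPoints A (γ t),
        dist p q ≤ K * (n + 1) := by
  -- At distance at least `3K` from `A`, a move of length `2K = 3K - K` displaces the projection by
  -- at most `K`: this is the factor one half.
  have base : ∀ s t : ℝ, 0 ≤ s → s ≤ t → t ≤ ℓ →
      (∀ u ∈ Set.Icc s t, 3 * K ≤ Metric.infDist (γ u) A) →
      t - s ≤ 2 * K → ∀ p ∈ closestPoints A (γ s), ∀ q ∈ closestPoints A (γ t),
        dist p q ≤ K := by
    intro s t hs hst ht hfar hlen p hp q hq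
    refine hA.2 (γ s) (γ t) ?_ p (Or.inl hp) q (Or.inr hq)
    rw [hγ s ⟨hs, hst.trans ht⟩ t ⟨hs.trans hst, ht⟩, abs_sub_comm, abs_of_nonneg (by linarith)]
    linarith [hfar s ⟨le_rfl, hst⟩]
  induction n with
  | zero =>
    intro s t hs hst ht hfar hlen p hp q hq
    simpa using base s t hs hst ht hfar (by simpa using hlen) p hp q hq
  | succ n ih =>
    intro s t hs hst ht hfar hlen p hp q hq
    push_cast at hlen ⊢
    by_cases h : t - s ≤ 2 * K * (n + 1)
    · have := ih s t hs hst ht hfar h p hp q hq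
      nlinarith
    · have hn : (0 : ℝ) ≤ n := n.cast_nonneg
      have h2 : s + 2 * K ≤ t := by nlinarith
      obtain ⟨p', hp'⟩ := hA.1 (γ (s + 2 * K))
      have h3 := base s (s + 2 * K) hs (by linarith) (by linarith)
        (fun u hu => hfar u ⟨hu.1, hu.2.trans h2⟩) (by linarith) p hp p' hp'
      have h4 := ih (s + 2 * K) t (by linarith) h2 ht
        (fun u hu => hfar u ⟨by linarith [hu.1], hu.2⟩) (by linarith) p' hp' q hq
      linarith [dist_triangle p p' q]

/-- Over lengths `d(γ s, A) - K` and `d(γ t, A) - K` at the two ends, the projection moves by at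
most `K`. The geodesic is no longer than the path through `p` and `q`, so the middle part has length
at most `d(p, q) + 2K`, and the half speed bound gives `d(p, q) ≤ 2K + (d(p, q) + 2K) / 2 + K`. -/
lemma IsContractingSet.dist_proj_le_eight {K : ℝ} {A : Set X} (hA : IsContractingSet K A)
    {γ : ℝ → X} {ℓ : ℝ}
    (hγ : ∀ s ∈ Set.Icc 0 ℓ, ∀ t ∈ Set.Icc 0 ℓ, dist (γ s) (γ t) = |s - t|) (hK : 0 < K)
    {s t : ℝ} (hs : 0 ≤ s) (hst : s ≤ t) (ht : t ≤ ℓ)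
    (hfar : ∀ u ∈ Set.Icc s t, 3 * K ≤ Metric.infDist (γ u) A)
    {p q : X} (hp : p ∈ closestPoints A (γ s)) (hq : q ∈ closestPoints A (γ t)) :
    dist p q ≤ 8 * K := by
  have dst : ∀ u v : ℝ, s ≤ u → u ≤ v → v ≤ t → dist (γ u) (γ v) = v - u := by
    intro u v h1 h2 h3
    rw [hγ u ⟨hs.trans h1, by linarith⟩ v ⟨by linarith, by linarith⟩, abs_sub_comm,
      abs_of_nonneg (by linarith)]
  have hrs := hfar s ⟨le_rfl, hst⟩
  have hrt := hfar t ⟨hst, le_rfl⟩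
  have hlen : t - s ≤ Metric.infDist (γ s) A + dist p q + Metric.infDist (γ t) A := by
    rw [← dst s t le_rfl hst le_rfl, ← hp.2, ← hq.2, dist_comm (γ t) q]
    exact dist_triangle4 _ _ _ _
  by_cases h1 : t - s ≤ Metric.infDist (γ s) A - K
  · have := hA.2 (γ s) (γ t) (by rw [dst s t le_rfl hst le_rfl]; exact h1) p (Or.inl hp) q
      (Or.inr hq)
    linarith
  by_cases h2 : t - s ≤ Metric.infDist (γ t) A - K
  · have := hA.2 (γ t) (γ s) (by rw [dist_comm, dst s t le_rfl hst le_rfl]; exact h2) p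
      (Or.inr hp) q (Or.inl hq)
    linarith
  push Not at h1 h2
  set s' := s + (Metric.infDist (γ s) A - K) with hs'
  set t' := t - (Metric.infDist (γ t) A - K) with ht'
  obtain ⟨p', hp'⟩ := hA.1 (γ s')
  obtain ⟨q', hq'⟩ := hA.1 (γ t')
  have hpp : dist p p' ≤ K :=
    hA.2 (γ s) (γ s') (by rw [dst s s' le_rfl (by linarith) (by linarith)]; linarith) p
      (Or.inl hp) p' (Or.inr hp')
  have hqq : dist q' q ≤ K :=
    hA.2 (γ t) (γ t') (by rw [dist_comm, dst t' t (by linarith) (by linarith) le_rfl]; linarith)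
      q' (Or.inr hq') q (Or.inl hq)
  by_cases h3 : s' ≤ t'
  · set n := ⌊(t' - s') / (2 * K)⌋₊
    have hn : (t' - s') / (2 * K) < n + 1 := Nat.lt_floor_add_one _
    have hn' : (n : ℝ) ≤ (t' - s') / (2 * K) := Nat.floor_le (by
      apply div_nonneg <;> linarith)
    rw [div_lt_iff₀ (by linarith)] at hn
    rw [le_div_iff₀ (by linarith)] at hn'
    have := hA.dist_proj_le_of_far hγ hK n s' t' (by linarith) h3 (by linarith)
      (fun u hu => hfar u ⟨by linarith [hu.1], by linarith [hu.2]⟩) (by linarith) p' hp' q' hq'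
    linarith [dist_triangle4 p p' q' q]
  · push Not at h3
    have : dist p' q ≤ K :=
      hA.2 (γ t) (γ s') (by
        rw [dist_comm, dst s' t (by linarith) (by linarith) le_rfl]; linarith)
        p' (Or.inr hp') q (Or.inl hq)
    linarith [dist_triangle p p' q]

/-- If the projections of `x` and `y` are far apart, a geodesic from `x` to `y` passes near the
projection of `x`. -/
lemma IsContractingSet.dist_add_le (hX : IsGeodesicSpace X) {K : ℝ} {A : Set X}
    (hA : IsContractingSet K A) (hK : 0 < K) {x y p q : X} (hp : p ∈ closestPoints A x)
    (hq : q ∈ closestPoints A y) (hpq : 8 * K < dist p q) :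
    dist x p + dist p y ≤ dist x y + 22 * K := by
  obtain ⟨γ, h0, h1, hγ⟩ := hX x y
  set ℓ := dist x y with hℓ
  have hℓ0 : 0 ≤ ℓ := dist_nonneg
  have hcont : ContinuousOn γ (Set.Icc 0 ℓ) := by
    have : LipschitzOnWith 1 γ (Set.Icc 0 ℓ) := by
      apply LipschitzOnWith.of_dist_le_mul
      intro s hs t ht
      rw [hγ s hs t ht, Real.dist_eq]; simp
    exact this.continuousOn
  -- The first time `u` in `Z` satisfies `d(γ u, p) ≤ 3K + 8K = 11K`, hence the constant `22K`.
  set Z := {u ∈ Set.Icc 0 ℓ | Metric.infDist (γ u) A ≤ 3 * K} with hZ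
  have hZcl : IsCompact Z := by
    have : IsClosed Z := by
      have := (Metric.continuous_infDist_pt A).comp_continuousOn hcont
      exact this.preimage_isClosed_of_isClosed isClosed_Icc (isClosed_Iic (a := 3 * K))
    exact isCompact_Icc.of_isClosed_subset this (fun u hu => hu.1)
  have hZne : Z.Nonempty := by
    by_contra hne
    rw [Set.not_nonempty_iff_eq_empty] at hne
    have hfar : ∀ u ∈ Set.Icc 0 ℓ, 3 * K ≤ Metric.infDist (γ u) A := by
      intro u hu
      by_contra hcon
      have : u ∈ Z := ⟨hu, by linarith⟩
      rw [hne] at this; exact this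
    have := hA.dist_proj_le_eight hγ hK le_rfl hℓ0 le_rfl hfar (by rwa [h0]) (by rwa [h1])
    linarith
  obtain ⟨u, hu, hmin⟩ := hZcl.exists_isLeast hZne
  have hfar : ∀ v ∈ Set.Ico 0 u, 3 * K < Metric.infDist (γ v) A := by
    intro v hv
    by_contra hcon
    have : v ∈ Z := ⟨⟨hv.1, hv.2.le.trans hu.1.2⟩, by linarith⟩
    linarith [hmin this, hv.2]
  obtain ⟨p', hp'⟩ := hA.1 (γ u)
  have hup : dist (γ u) p ≤ 11 * K := by
    rcases hu.1.1.eq_or_lt with h | h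
    · have h3 := hu.2
      rw [← h, h0] at h3 ⊢
      rw [hp.2]; exact h3.trans (by linarith)
    -- The bound on `[0, u)` extends to the endpoint `u` by continuity.
    · have hfar' : ∀ v ∈ Set.Icc 0 u, 3 * K ≤ Metric.infDist (γ v) A := by
        have hc : ContinuousOn (fun v => Metric.infDist (γ v) A) (Set.Icc 0 u) :=
          (Metric.continuous_infDist_pt A).comp_continuousOn
            (hcont.mono (Set.Icc_subset_Icc le_rfl hu.1.2))
        intro v hv
        rcases hv.2.eq_or_lt with h' | h'
        · subst h'
          have hmem : v ∈ closure (Set.Ico 0 v) := by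
            rw [closure_Ico h.ne]; exact ⟨h.le, le_rfl⟩
          have hcw : ContinuousWithinAt (fun v => Metric.infDist (γ v) A) (Set.Ico 0 v) v :=
            (hc v ⟨h.le, le_rfl⟩).mono Set.Ico_subset_Icc_self
          have := mem_closure_iff_nhdsWithin_neBot.1 hmem
          exact ge_of_tendsto hcw (eventually_mem_nhdsWithin.mono fun w hw => (hfar w hw).le)
        · exact (hfar v ⟨hv.1, h'⟩).le
      have := hA.dist_proj_le_eight hγ hK le_rfl h.le hu.1.2 hfar' (by rwa [h0]) hp'
      have h3 : dist (γ u) p' ≤ 3 * K := by rw [hp'.2]; exact hu.2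
      linarith [dist_triangle (γ u) p' p, dist_comm p p']
  have e1 : dist x (γ u) = u := by
    rw [← h0, hγ 0 ⟨le_rfl, hℓ0⟩ u hu.1, zero_sub, abs_neg, abs_of_nonneg hu.1.1]
  have e2 : dist (γ u) y = ℓ - u := by
    conv_lhs => rw [← h1]
    rw [hγ u hu.1 ℓ ⟨hℓ0, le_rfl⟩, abs_sub_comm, abs_of_nonneg (by linarith [hu.1.2])]
  linarith [dist_triangle x (γ u) p, dist_triangle p (γ u) y, dist_comm p (γ u)]

lemma IsContractingSet.dist_add_le_of_mem (hX : IsGeodesicSpace X) {K : ℝ} {A : Set X}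
    (hA : IsContractingSet K A) (hK : 0 < K) {x y p : X} (hp : p ∈ closestPoints A x)
    (hy : y ∈ A) : dist x p + dist p y ≤ dist x y + 22 * K := by
  by_cases h : 8 * K < dist p y
  · exact hA.dist_add_le hX hK hp (mem_closestPoints_self hy) h
  · linarith [dist_le_of_mem_closestPoints hy hp]

/-- Coarse Lipschitz property: if `d(p, q)` is large, the path from `x` to `y` passes near `p`, and
the path from `y` to `p` passes near `q`; adding the two inequalities isolates `d(p, q)`. -/
lemma IsContractingSet.dist_proj_le (hX : IsGeodesicSpace X) {K : ℝ} {A : Set X}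
    (hA : IsContractingSet K A) (hK : 0 < K) {x y p q : X} (hp : p ∈ closestPoints A x)
    (hq : q ∈ closestPoints A y) : dist p q ≤ dist x y + 44 * K := by
  by_cases h : 8 * K < dist p q
  · have h1 := hA.dist_add_le hX hK hp hq h
    have h2 := hA.dist_add_le_of_mem hX hK hq hp.1
    linarith [dist_comm p y, dist_comm p q, dist_nonneg (x := x) (y := p),
      dist_nonneg (x := y) (y := q)]
  · linarith [dist_nonneg (x := x) (y := y)]

end ContractingGeometry

/-! ### Behrstock inequality and orbits of independent elements -/

section IsometricAction

set_option linter.unusedSectionVars false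

variable {X G : Type*} [MetricSpace X] [Group G] [MulAction G X] [IsIsometricSMul G X]

/-- Behrstock inequality for a contracting set `A` and a translate `k B` of a contracting set. -/
lemma IsContractingSet.behrstock (hX : IsGeodesicSpace X) {K : ℝ} {A B : Set X}
    (hA : IsContractingSet K A) (hB : IsContractingSet K B) (hK : 0 < K) (k : G)
    {x a b a' b' : X} (ha : a ∈ closestPoints A x) (hb : b ∈ closestPoints B (k⁻¹ • x))
    (ha' : a' ∈ closestPoints A (k • b)) (hb' : b' ∈ closestPoints B (k⁻¹ • a)) :
    dist a a' ≤ 44 * K ∨ dist b b' ≤ 44 * K := by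
  -- Otherwise geodesics from `x` to `k b` pass near `a`, and those from `x` to `a` pass near `k b`.
  -- Adding up, `d(a, k b) ≤ 22K`, so that `d(b, b') ≤ 44K`.
  by_contra! h
  have h1 := hA.dist_add_le hX hK ha ha' (by linarith)
  have h2 := hB.dist_add_le hX hK hb hb' (by linarith)
  have e1 : dist (k⁻¹ • x) b = dist x (k • b) := by
    rw [← dist_smul k (k⁻¹ • x) b, smul_inv_smul]
  have e2 : dist b (k⁻¹ • a) = dist a (k • b) := by
    rw [← dist_smul k b (k⁻¹ • a), smul_inv_smul, dist_comm]
  rw [e1, e2, dist_smul] at h2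
  have h3 := dist_le_of_mem_closestPoints hb.1 hb'
  rw [dist_comm _ b, e2] at h3
  linarith [dist_triangle b (k⁻¹ • a) b']

lemma closestPoints_smul {A : Set X} {h : G} (hinv : ∀ x, h • x ∈ A ↔ x ∈ A) {x p : X} :
    h • p ∈ closestPoints A (h • x) ↔ p ∈ closestPoints A x := by
  have : Metric.infDist (h • x) A = Metric.infDist x A := by
    have himg : A = (fun y => h • y) '' A := by
      ext y
      constructor
      · intro hy
        exact ⟨h⁻¹ • y, by rw [← hinv, smul_inv_smul]; exact hy, smul_inv_smul h y⟩
      · rintro ⟨z, hz, rfl⟩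
        exact (hinv z).2 hz
    conv_lhs => rw [himg]
    exact Metric.infDist_image (isometry_smul X h)
  simp only [closestPoints, Set.mem_ofPred_eq, hinv, dist_smul, this]

variable (o : X)

/-- The orbit of the basepoint under the cyclic group generated by `h`. -/
def cyclicOrbit (h : G) : Set X := Set.range fun n : ℤ => h ^ n • o

lemma base_mem_cyclicOrbit (h : G) : o ∈ cyclicOrbit o h := ⟨0, by simp⟩

lemma zpow_smul_mem_cyclicOrbit_iff (h : G) (n : ℤ) (x : X) :
    h ^ n • x ∈ cyclicOrbit o h ↔ x ∈ cyclicOrbit o h := by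
  constructor
  · rintro ⟨m, hm⟩
    refine ⟨-n + m, ?_⟩
    simp only at hm ⊢
    rw [zpow_add, mul_smul, hm, zpow_neg, inv_smul_smul]
  · rintro ⟨m, rfl⟩
    exact ⟨n + m, by simp only [zpow_add, mul_smul]⟩

lemma closestPoints_zpow_smul (h : G) (n : ℤ) {x p : X} :
    h ^ n • p ∈ closestPoints (cyclicOrbit o h) (h ^ n • x) ↔
      p ∈ closestPoints (cyclicOrbit o h) x :=
  closestPoints_smul (zpow_smul_mem_cyclicOrbit_iff o h n)

lemma AreIndependent.symm {g h : G} (H : AreIndependent o g h) : AreIndependent o h g := by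
  intro M hM
  have := (H M hM)
  have h2 := (LipschitzWith.prod_snd.prodMk LipschitzWith.prod_fst :
    LipschitzWith _ (fun p : ℤ × ℤ => (p.2, p.1))).isBounded_image this
  refine h2.subset ?_
  rintro ⟨n, m⟩ hnm
  exact ⟨(m, n), by simpa [dist_comm] using hnm, rfl⟩

lemma AreIndependent.exists_bound {g h : G} (H : AreIndependent o g h) (M : ℝ) :
    ∃ N : ℝ, ∀ n m : ℤ, dist (g ^ n • o) (h ^ m • o) ≤ M → |(m : ℝ)| ≤ N := by
  obtain ⟨C, hC⟩ := (H (|M| + 1) (by positivity)).exists_norm_le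
  refine ⟨C, fun n m hnm => ?_⟩
  have : ‖((n, m) : ℤ × ℤ)‖ ≤ C := hC (n, m) (by
    simp only [Set.mem_ofPred_eq]; linarith [le_abs_self M])
  have h2 := (norm_snd_le ((n, m) : ℤ × ℤ)).trans this
  simpa [Int.norm_eq_abs] using h2

/-- Independent contracting elements have orbits with bounded projections to each other. -/
lemma AreIndependent.exists_proj_bound (hX : IsGeodesicSpace X) {K : ℝ} (hK : 0 < K) {g h : G}
    (H : AreIndependent o g h) (hg : IsContractingAxis K (fun n : ℤ => g ^ n • o))
    (hh : IsContractingAxis K (fun n : ℤ => h ^ n • o)) :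
    ∃ C : ℝ, ∀ x ∈ cyclicOrbit o g, ∀ p ∈ closestPoints (cyclicOrbit o h) x, dist o p ≤ C := by
  -- With `q` the projection of `p` to the orbit of `g`, the three inequalities below add up to `2
  -- d(p, q) ≤ 66K`; independence then bounds the exponent of `p`.
  obtain ⟨N, hN⟩ := H.exists_bound o (33 * K)
  refine ⟨K * N + K, fun x hx p hp => ?_⟩
  obtain ⟨q, hq⟩ := hg.2.1 p
  have h1 := hg.2.dist_add_le_of_mem hX hK hq hx
  have h2 := hg.2.dist_add_le_of_mem hX hK hq (base_mem_cyclicOrbit o g)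
  have h3 := hh.2.dist_add_le_of_mem hX hK hp (base_mem_cyclicOrbit o h)
  have h4 : dist q p ≤ 33 * K := by
    linarith [dist_triangle x q o, dist_comm x p, dist_comm x q, dist_comm p q]
  obtain ⟨m, rfl⟩ := hp.1
  obtain ⟨n, rfl⟩ := hq.1
  have h5 := hN n m h4
  have h6 := (hh.1 0 m).2
  simp only [zpow_zero, one_smul, Int.cast_zero, zero_sub, abs_neg] at h6
  exact h6.trans (by gcongr)

/-- Suitable powers `f` of `g` push the orbit of `h` away from itself. -/
lemma AreIndependent.exists_pow_proj_bound (hX : IsGeodesicSpace X) {K : ℝ} (hK : 0 < K) {g h : G}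
    (H : AreIndependent o g h) (hg : IsContractingAxis K (fun n : ℤ => g ^ n • o))
    (hh : IsContractingAxis K (fun n : ℤ => h ^ n • o)) :
    ∃ (C : ℝ) (P : ℕ), ∀ m : ℤ, m ≠ 0 → ∀ x ∈ cyclicOrbit o h,
      ∀ p ∈ closestPoints (cyclicOrbit o h) ((g ^ P) ^ m • x), dist o p ≤ C := by
  have hgA : IsContractingSet K (cyclicOrbit o g) := hg.2
  have hhA : IsContractingSet K (cyclicOrbit o h) := hh.2
  obtain ⟨C₁, hC₁⟩ := H.exists_proj_bound o hX hK hg hh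
  obtain ⟨C₂, hC₂⟩ := (H.symm o).exists_proj_bound o hX hK hh hg
  obtain ⟨P, hP⟩ := exists_nat_gt (K * (2 * C₂ + 44 * K + K))
  refine ⟨C₁ + 44 * K, P, fun m hm x hx p hp => ?_⟩
  have hpow : (g ^ P) ^ m = g ^ ((P : ℤ) * m) := by rw [zpow_mul, zpow_natCast]
  rw [hpow] at hp
  set n : ℤ := (P : ℤ) * m
  have hn : K * (2 * C₂ + 44 * K + K) < |(n : ℝ)| := by
    have h1 : (1 : ℝ) ≤ |(m : ℝ)| := by exact_mod_cast Int.one_le_abs hm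
    have h2 : |(n : ℝ)| = P * |(m : ℝ)| := by
      simp [n, abs_mul]
    rw [h2]
    nlinarith [(Nat.cast_nonneg P : (0 : ℝ) ≤ P)]
  obtain ⟨b, hb⟩ := hgA.1 (g ^ n • x)
  obtain ⟨a', ha'⟩ := hhA.1 b
  obtain ⟨b', hb'⟩ := hgA.1 p
  have h1 := hC₁ b hb.1 a' ha'
  have h2 := hC₂ p hp.1 b' hb'
  have hb2 : dist (g ^ n • o) b ≤ C₂ := by
    have : g ^ n • (g ^ (-n) • b) ∈ closestPoints (cyclicOrbit o g) (g ^ n • x) := by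
      rw [← mul_smul, ← zpow_add]; simpa using hb
    rw [closestPoints_zpow_smul] at this
    have h3 := hC₂ x hx _ this
    rwa [← dist_smul (g ^ n), ← mul_smul, ← zpow_add, add_neg_cancel, zpow_zero, one_smul] at h3
  rcases hhA.behrstock hX hgA hK (1 : G) hp (by simpa using hb) (by simpa using ha')
    (by simpa using hb') with h | h
  · linarith [dist_triangle o a' p, dist_comm p a']
  · exfalso
    have h3 : dist o (g ^ n • o) ≤ 2 * C₂ + 44 * K := by
      linarith [dist_triangle4 o b' b (g ^ n • o), dist_comm b b', dist_comm b (g ^ n • o)]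
    have h4 := (hg.1 0 n).1
    simp only [zpow_zero, one_smul, Int.cast_zero, zero_sub, abs_neg] at h4
    have h5 : |(n : ℝ)| / K ≤ 2 * C₂ + 44 * K + K := by linarith
    rw [div_le_iff₀ hK] at h5
    linarith

end IsometricAction

/-! ### Aligned words and Schottky families -/

section Schottky

variable {X G ι : Type*} [MetricSpace X] [Group G] [MulAction G X]

/-- The product `h₀ s₁ h₁ s₂ h₂ ⋯ sₘ hₘ`, for a list `(sₘ, hₘ), …, (s₁, h₁)`. -/
def wordEval (s : ι → G) (h₀ : G) : List (ι × G) → G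
  | [] => h₀
  | (a, h) :: w => wordEval s h₀ w * s a * h

/-- The rightmost factor of the product `h₀ s₁ h₁ s₂ h₂ ⋯ sₘ hₘ`. -/
def lastGap (h₀ : G) : List (ι × G) → G
  | [] => h₀
  | (_, h) :: _ => h

/-- Each letter of the word is in good position with respect to the two gaps next to it. -/
def IsAlignedWord (left : G → ι → Prop) (right : ι → G → Prop) (h₀ : G) : List (ι × G) → Prop
  | [] => True
  | (a, h) :: w => IsAlignedWord left right h₀ w ∧ left (lastGap h₀ w) a ∧ right a h

/-- The total length of the gaps of a word, where each gap counts for at least `1`. -/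
noncomputable def gapLength (o : X) : List (ι × G) → ℝ
  | [] => 0
  | (_, h) :: w => gapLength o w + (1 + dist o (h • o))

open Classical in
/-- A Schottky family: for any given gap, most letters are in good position with respect to it,
and words all of whose letters are in good position have the expected length. -/
structure IsSchottky [Fintype ι] (o : X) (η : ℝ) (s : ι → G) (left : G → ι → Prop)
    (right : ι → G → Prop) : Prop where
  left_bad : ∀ h, ((Finset.univ.filter fun a => ¬ left h a).card : ℝ) ≤ η * Fintype.card ι
  right_bad : ∀ h, ((Finset.univ.filter fun a => ¬ right a h).card : ℝ) ≤ η * Fintype.card ι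
  length_le : ∀ h₀ w, IsAlignedWord left right h₀ w →
    gapLength o w ≤ dist o (wordEval s h₀ w • o)

end Schottky

/-! ### Propagating alignment from one axis to the next -/

section Alignment

variable {X G : Type*} [MetricSpace X] [Group G] [MulAction G X] [IsIsometricSMul G X]

lemma dist_inv_smul_left (k : G) (x y : X) : dist (k⁻¹ • x) y = dist x (k • y) := by
  rw [← dist_smul k (k⁻¹ • x) y, smul_inv_smul]

lemma dist_inv_smul_right (k : G) (x y : X) : dist x (k⁻¹ • y) = dist (k • x) y := by
  rw [← dist_smul k x (k⁻¹ • y), smul_inv_smul]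

variable {A : Set X} {K c c' : ℝ} {e e' x₀ y : X} {k₁ k₂ : G}

/-- Let `e, e'` be the entry and exit points of a contracting axis `A`. If `x₀` projects to the
translate `k₁ A` near the entry point and `y` projects near the exit point, then the distance
from `x₀` to `y` is coarsely realized by a path along the axis. -/
lemma IsContractingSet.dist_through_axis (hX : IsGeodesicSpace X) (hA : IsContractingSet K A)
    (hK : 0 < K) (he' : e' ∈ A)
    (hi : ∀ p ∈ closestPoints A (k₁⁻¹ • x₀), dist e p ≤ c')
    (ho : ∀ p ∈ closestPoints A (k₁⁻¹ • y), dist e' p ≤ c)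
    (hD : c + c' + 8 * K < dist e e') :
    dist x₀ (k₁ • e) + dist e e' + dist (k₁ • e') y ≤ dist x₀ y + 44 * K + 2 * c + 2 * c' := by
  obtain ⟨u, hu⟩ := hA.1 (k₁⁻¹ • x₀)
  obtain ⟨r, hr⟩ := hA.1 (k₁⁻¹ • y)
  have hu1 := hi u hu
  have hr1 := ho r hr
  have h1 := hA.dist_add_le hX hK hr hu (by linarith [dist_triangle4 e u r e', dist_comm u r, dist_comm r e'])
  have h2 := hA.dist_add_le_of_mem hX hK hu he'
  rw [dist_inv_smul_left, dist_smul] at h1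
  rw [dist_inv_smul_left, dist_inv_smul_left] at h2
  have e1 : dist (k₁ • e) (k₁ • u) ≤ c' := by rwa [dist_smul]
  have e2 : dist (k₁ • e') (k₁ • r) ≤ c := by rwa [dist_smul]
  have e3 : dist r (k₁⁻¹ • x₀) = dist (k₁ • r) x₀ := dist_inv_smul_right _ _ _
  have e4 := dist_triangle x₀ (k₁ • u) (k₁ • e)
  have e5 := dist_triangle e u e'
  have e6 := dist_triangle (k₁ • e') (k₁ • r) y
  have e7 := dist_triangle x₀ (k₁ • r) (k₁ • e')
  linarith [dist_comm (k₁ • u) (k₁ • e), dist_comm (k₁ • r) y, dist_comm (k₁ • r) x₀,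
    dist_comm y x₀, dist_comm (k₁ • r) (k₁ • e')]

/-- Local alignment of two consecutive axes propagates the position of the projection of a far
away point `x₀`. -/
lemma IsContractingSet.proj_next_axis (hX : IsGeodesicSpace X) (hA : IsContractingSet K A)
    (hK : 0 < K) (he : e ∈ A) (he' : e' ∈ A)
    (hi : ∀ p ∈ closestPoints A (k₁⁻¹ • x₀), dist e p ≤ c')
    (h12 : ∀ p ∈ closestPoints A (k₁⁻¹ • k₂ • e), dist e' p ≤ c)
    (h21 : ∀ p ∈ closestPoints A (k₂⁻¹ • k₁ • e), dist e p ≤ c)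
    (hD : 33 * K + 2 * c + c' < dist e e') :
    ∀ p ∈ closestPoints A (k₂⁻¹ • x₀), dist e p ≤ c + 8 * K := by
  intro p hp
  obtain ⟨q, hq⟩ := hA.1 (k₂⁻¹ • k₁ • e)
  obtain ⟨r, hr⟩ := hA.1 (k₁⁻¹ • k₂ • e)
  obtain ⟨u, hu⟩ := hA.1 (k₁⁻¹ • x₀)
  have hq1 := h21 q hq
  -- If the conclusion failed, geodesics from `k₁ e` to `x₀` would pass near `k₁ e'`, then `k₂ e`,
  -- while those from `x₀` to `k₁ e'` pass near `k₁ e`. The segment from `k₁ e` to `k₁ e'` would be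
  -- counted twice for nothing, giving `2 d(e, e') ≤ 66K + 4c + 2c'`.
  by_contra! hcon
  have h1 := hA.dist_add_le hX hK hq hp (by linarith [dist_triangle e q p])
  have h2 := hA.dist_add_le_of_mem hX hK hr he
  have h3 := hA.dist_add_le_of_mem hX hK hu he'
  have hr1 := h12 r hr
  have hu1 := hi u hu
  rw [dist_inv_smul_left, dist_inv_smul_left, smul_inv_smul] at h1
  rw [dist_inv_smul_left, dist_inv_smul_left] at h2 h3
  have e0 : dist q (k₂⁻¹ • x₀) = dist (k₂ • q) x₀ := dist_inv_smul_right _ _ _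
  have e1 : dist (k₂ • e) (k₂ • q) ≤ c := by rwa [dist_smul]
  have e2 : dist (k₁ • e') (k₁ • r) ≤ c := by rwa [dist_smul]
  have e3 : dist (k₁ • e) (k₁ • u) ≤ c' := by rwa [dist_smul]
  have t1 := dist_triangle (k₁ • e) (k₂ • q) (k₂ • e)
  have t2 := dist_triangle (k₂ • e) (k₂ • q) x₀
  have t3 := dist_triangle (k₂ • e) (k₁ • r) (k₁ • e')
  have t4 := dist_triangle e' r e
  have t5 := dist_triangle x₀ (k₁ • u) (k₁ • e)
  have t6 := dist_triangle e u e'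
  have t7 := dist_triangle x₀ (k₂ • e) (k₁ • e')
  linarith [dist_comm (k₂ • q) (k₂ • e), dist_comm (k₁ • r) (k₁ • e'),
    dist_comm (k₁ • u) (k₁ • e), dist_comm e e', dist_comm (k₁ • e) x₀, dist_comm (k₂ • e) x₀,
    dist_comm (k₁ • e) (k₂ • e), dist_nonneg (x := x₀) (y := k₂ • e),
    dist_nonneg (x := k₂ • e) (y := k₁ • e')]

end Alignment

/-! ### Construction of a Schottky family from two independent contracting elements -/

section Construction

variable {X G : Type*} [MetricSpace X] [Group G] [MulAction G X]

/-- The letters `f ^ i h ^ Q f ^ n h ^ Q f ^ j`, with `1 ≤ i ≤ a`, `1 ≤ j ≤ b`, and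
`i + n + j = a + b + 1`. -/
def schottkyLetter (f h : G) (Q a b : ℕ) (p : Fin a × Fin b) : G :=
  f ^ (p.1 + 1 : ℕ) * h ^ Q * f ^ (a + b - 1 - p.1 - p.2 : ℕ) * h ^ Q * f ^ (p.2 + 1 : ℕ)

/-- The projection of `x` to the orbit of `h` is close to the basepoint. -/
def ProjNear (o : X) (h : G) (c : ℝ) (x : X) : Prop :=
  ∀ p ∈ closestPoints (cyclicOrbit o h) x, dist o p ≤ c

/-- The letter is in good position with respect to the gap on its left. -/
def schottkyLeft (o : X) (f h : G) (c : ℝ) (Q a b : ℕ) (g : G) (p : Fin a × Fin b) : Prop :=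
  ProjNear o h c ((f ^ (p.1 + 1 : ℕ))⁻¹ • g⁻¹ • o) ∧
    ∀ j : Fin b, ProjNear o h c
      ((f ^ (p.1 + 1 : ℕ))⁻¹ • g⁻¹ • (f ^ (j + 1 : ℕ))⁻¹ • (h ^ Q)⁻¹ • o)

/-- The letter is in good position with respect to the gap on its right. -/
def schottkyRight (o : X) (f h : G) (c : ℝ) (a b : ℕ) (p : Fin a × Fin b) (g : G) : Prop :=
  ProjNear o h c (f ^ (p.2 + 1 : ℕ) • g • o)

variable [IsIsometricSMul G X] {o : X} {f h : G} {K c : ℝ}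

/-- A point has a far away projection to at most one of the axes `f ^ n • cyclicOrbit o h`. -/
lemma ProjNear.of_not (hX : IsGeodesicSpace X) (hK : 0 < K)
    (hA : IsContractingSet K (cyclicOrbit o h))
    (hf : ∀ m : ℤ, m ≠ 0 → ∀ x ∈ cyclicOrbit o h, ProjNear o h c (f ^ m • x)) {x : X} {i j : ℤ}
    (hij : i ≠ j) (hi : ¬ ProjNear o h (c + 44 * K) ((f ^ i)⁻¹ • x)) :
    ProjNear o h (c + 44 * K) ((f ^ j)⁻¹ • x) := by
  intro q hq
  by_contra! hcon
  simp only [ProjNear, not_forall, not_le] at hi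
  obtain ⟨p, hp, hpd⟩ := hi
  have hx : (f ^ (j - i))⁻¹ • (f ^ i)⁻¹ • x = (f ^ j)⁻¹ • x := by
    rw [← mul_smul, ← mul_inv_rev, ← zpow_add, add_sub_cancel]
  obtain ⟨a', ha'⟩ := hA.1 (f ^ (j - i) • q)
  obtain ⟨b', hb'⟩ := hA.1 ((f ^ (j - i))⁻¹ • p)
  have h1 := hf (j - i) (sub_ne_zero.2 hij.symm) q hq.1 a' ha'
  have h2 : dist o b' ≤ c := by
    have := hf (i - j) (sub_ne_zero.2 hij) p hp.1
    rw [← neg_sub, zpow_neg] at this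
    exact this b' hb'
  rcases hA.behrstock hX hA hK (f ^ (j - i)) hp (by rwa [hx]) ha' hb' with h | h
  · linarith [dist_triangle o a' p, dist_comm a' p]
  · linarith [dist_triangle o b' q, dist_comm b' q]

open Classical in
lemma card_not_projNear_le (hX : IsGeodesicSpace X) (hK : 0 < K)
    (hA : IsContractingSet K (cyclicOrbit o h))
    (hf : ∀ m : ℤ, m ≠ 0 → ∀ x ∈ cyclicOrbit o h, ProjNear o h c (f ^ m • x)) (x : X) (a : ℕ) :
    (Finset.univ.filter fun i : Fin a =>
      ¬ ProjNear o h (c + 44 * K) ((f ^ (i + 1 : ℕ))⁻¹ • x)).card ≤ 1 := by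
  rw [Finset.card_le_one]
  intro i hi j hj
  simp only [Finset.mem_filter, Finset.mem_univ, true_and] at hi hj
  by_contra hij
  have : ((i + 1 : ℕ) : ℤ) ≠ ((j + 1 : ℕ) : ℤ) := by
    intro h; apply hij; ext; exact_mod_cast (by simpa using h)
  rw [← zpow_natCast] at hi hj
  exact hj (ProjNear.of_not hX hK hA hf this hi)

open Classical in
lemma card_not_projNear_le' (hX : IsGeodesicSpace X) (hK : 0 < K)
    (hA : IsContractingSet K (cyclicOrbit o h))
    (hf : ∀ m : ℤ, m ≠ 0 → ∀ x ∈ cyclicOrbit o h, ProjNear o h c (f ^ m • x)) (x : X) (a : ℕ) :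
    (Finset.univ.filter fun i : Fin a =>
      ¬ ProjNear o h (c + 44 * K) (f ^ (i + 1 : ℕ) • x)).card ≤ 1 := by
  rw [Finset.card_le_one]
  intro i hi j hj
  simp only [Finset.mem_filter, Finset.mem_univ, true_and] at hi hj
  by_contra hij
  have : -((i + 1 : ℕ) : ℤ) ≠ -((j + 1 : ℕ) : ℤ) := by
    intro h; apply hij; ext; exact_mod_cast (by simpa using h)
  have e : ∀ n : ℕ, f ^ n = (f ^ (-(n : ℤ)))⁻¹ := by simp
  rw [e] at hi hj
  exact hj (ProjNear.of_not hX hK hA hf this hi)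

open Classical in
-- The left condition tests `b + 1` points, and by the Behrstock inequality each of them excludes at
-- most one exponent `i`; the exponent `j` is then free.
lemma schottkyLeft_bad (hX : IsGeodesicSpace X) (hK : 0 < K)
    (hA : IsContractingSet K (cyclicOrbit o h))
    (hf : ∀ m : ℤ, m ≠ 0 → ∀ x ∈ cyclicOrbit o h, ProjNear o h c (f ^ m • x)) (Q a b : ℕ) (g : G) :
    (Finset.univ.filter fun p : Fin a × Fin b =>
      ¬ schottkyLeft o f h (c + 44 * K) Q a b g p).card ≤ (b + 1) * b := by
  set T : Option (Fin b) → X := fun j => j.elim (g⁻¹ • o)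
    fun j => g⁻¹ • (f ^ (j + 1 : ℕ))⁻¹ • (h ^ Q)⁻¹ • o with hT
  have hsub : (Finset.univ.filter fun p : Fin a × Fin b =>
      ¬ schottkyLeft o f h (c + 44 * K) Q a b g p) ⊆
      (Finset.univ.biUnion fun j : Option (Fin b) => Finset.univ.filter fun i : Fin a =>
        ¬ ProjNear o h (c + 44 * K) ((f ^ (i + 1 : ℕ))⁻¹ • T j)) ×ˢ Finset.univ := by
    rintro ⟨i, j⟩ hp
    simp only [schottkyLeft, Finset.mem_filter, Finset.mem_univ, true_and, not_and_or,
      not_forall] at hp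
    simp only [Finset.mem_product, Finset.mem_biUnion, Finset.mem_filter, Finset.mem_univ,
      true_and, and_true]
    rcases hp with hp | ⟨j', hp⟩
    · exact ⟨none, hp⟩
    · exact ⟨some j', hp⟩
  refine (Finset.card_le_card hsub).trans ?_
  rw [Finset.card_product, Finset.card_univ, Fintype.card_fin]
  refine Nat.mul_le_mul_right _ (Finset.card_biUnion_le.trans ?_)
  refine (Finset.sum_le_card_nsmul _ _ 1 fun j _ => card_not_projNear_le hX hK hA hf _ _).trans ?_
  simp

open Classical in
lemma schottkyRight_bad (hX : IsGeodesicSpace X) (hK : 0 < K)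
    (hA : IsContractingSet K (cyclicOrbit o h))
    (hf : ∀ m : ℤ, m ≠ 0 → ∀ x ∈ cyclicOrbit o h, ProjNear o h c (f ^ m • x)) (a b : ℕ) (g : G) :
    (Finset.univ.filter fun p : Fin a × Fin b =>
      ¬ schottkyRight o f h (c + 44 * K) a b p g).card ≤ a := by
  have hsub : (Finset.univ.filter fun p : Fin a × Fin b =>
      ¬ schottkyRight o f h (c + 44 * K) a b p g) ⊆
      Finset.univ ×ˢ (Finset.univ.filter fun i : Fin b =>
        ¬ ProjNear o h (c + 44 * K) (f ^ (i + 1 : ℕ) • g • o)) := by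
    rintro ⟨i, j⟩ hp
    exact Finset.mem_product.2 ⟨Finset.mem_univ _,
      Finset.mem_filter.2 ⟨Finset.mem_univ _, (Finset.mem_filter.1 hp).2⟩⟩
  refine (Finset.card_le_card hsub).trans ?_
  rw [Finset.card_product, Finset.card_univ, Fintype.card_fin]
  exact (Nat.mul_le_mul_left _ (card_not_projNear_le' hX hK hA hf _ _)).trans (by simp)

/-- The entry point of the second axis of the letter following the word `w`. -/
def secondEntry (f h : G) (Q a b : ℕ) (h₀ : G) (w : List ((Fin a × Fin b) × G))
    (p : Fin a × Fin b) : G :=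
  wordEval (schottkyLetter f h Q a b) h₀ w * f ^ (p.1 + 1 : ℕ) * h ^ Q *
    f ^ (a + b - 1 - p.1 - p.2 : ℕ)

lemma projNear_pow_smul {Q : ℕ} {x : X} (hx : ProjNear o h c x) :
    ∀ p ∈ closestPoints (cyclicOrbit o h) (h ^ Q • x), dist (h ^ Q • o) p ≤ c := by
  intro p hp
  have : h ^ (Q : ℤ) • (h ^ (-(Q : ℤ)) • p) ∈ closestPoints (cyclicOrbit o h)
      (h ^ (Q : ℤ) • x) := by
    rw [← mul_smul, ← zpow_add]; simpa using hp
  rw [closestPoints_zpow_smul] at this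
  have h3 := hx _ this
  rwa [zpow_neg, zpow_natCast, dist_inv_smul_right] at h3

/-- Induction along the axes of the word, two per letter. From the second axis of a letter one
crosses a gap to the first axis of the next letter, then a power of `f` to its second axis. Each
time `o` projects near the entry point, and the length of `h ^ Q` pays for all errors and for the
unit added to each gap. -/
lemma secondEntry_spec (hX : IsGeodesicSpace X) (hK : 0 < K)
    (hA : IsContractingSet K (cyclicOrbit o h)) (hc : 0 ≤ c)
    (hf : ∀ m : ℤ, m ≠ 0 → ∀ x ∈ cyclicOrbit o h, ProjNear o h c (f ^ m • x)) {Q a b : ℕ}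
    {C d : ℝ} (hC : ∀ i ≤ a + b, dist o (f ^ i • o) ≤ C) (hC0 : 0 ≤ C)
    (hd : d = c + 44 * K + C + 44 * K)
    (hQ : 200 * K + 10 * d + 2 * C + 1 ≤ dist o (h ^ Q • o)) (h₀ : G) :
    ∀ (w : List ((Fin a × Fin b) × G)) (p : Fin a × Fin b),
    IsAlignedWord (schottkyLeft o f h (c + 44 * K) Q a b) (schottkyRight o f h (c + 44 * K) a b)
      h₀ w →
    schottkyLeft o f h (c + 44 * K) Q a b (lastGap h₀ w) p →
    ProjNear o h (d + 8 * K) ((secondEntry f h Q a b h₀ w p)⁻¹ • o) ∧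
      gapLength o w ≤ dist o (secondEntry f h Q a b h₀ w p • o) := by
  intro w
  have hoA := base_mem_cyclicOrbit o h
  have hQA : h ^ Q • o ∈ cyclicOrbit o h := ⟨Q, by simp⟩
  have hQA' : (h ^ Q)⁻¹ • o ∈ cyclicOrbit o h := ⟨-(Q : ℤ), by simp⟩
  have inner : ∀ (w : List ((Fin a × Fin b) × G)) (p : Fin a × Fin b),
      ProjNear o h (d + 8 * K)
        ((wordEval (schottkyLetter f h Q a b) h₀ w * f ^ (p.1 + 1 : ℕ))⁻¹ • o) →
      ProjNear o h (d + 8 * K) ((secondEntry f h Q a b h₀ w p)⁻¹ • o) ∧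
      dist o ((wordEval (schottkyLetter f h Q a b) h₀ w * f ^ (p.1 + 1 : ℕ)) • o) ≤
        dist o (secondEntry f h Q a b h₀ w p • o) := by
    intro w p hp
    set k₁ := wordEval (schottkyLetter f h Q a b) h₀ w * f ^ (p.1 + 1 : ℕ) with hk₁
    set n := a + b - 1 - p.1 - p.2 with hn
    -- As `p.1 < a` and `p.2 < b`, the middle exponent is at least `1`, so that `hf` separates the
    -- two axes of the letter.
    have hn0 : (n : ℤ) ≠ 0 := by have := p.1.2; have := p.2.2; omega
    have hk₂ : secondEntry f h Q a b h₀ w p = k₁ * (h ^ Q * f ^ n) := by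
      simp only [secondEntry, hk₁, hn, mul_assoc]
    rw [hk₂]
    have h12 : ∀ q ∈ closestPoints (cyclicOrbit o h) (k₁⁻¹ • (k₁ * (h ^ Q * f ^ n)) • o),
        dist (h ^ Q • o) q ≤ d := by
      rw [← mul_smul, inv_mul_cancel_left, mul_smul]
      apply projNear_pow_smul
      intro q hq
      rw [← zpow_natCast] at hq
      linarith [hf n hn0 o hoA q hq]
    have h21 : ∀ q ∈ closestPoints (cyclicOrbit o h) ((k₁ * (h ^ Q * f ^ n))⁻¹ • k₁ • o),
        dist o q ≤ d := by
      rw [← mul_smul, mul_inv_rev, mul_assoc, inv_mul_cancel, mul_one, mul_inv_rev, mul_smul,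
        ← zpow_natCast f n, ← zpow_neg]
      intro q hq
      linarith [hf (-n) (by simpa using hn0) _ hQA' q hq]
    refine ⟨hA.proj_next_axis hX hK hoA hQA hp h12 h21 (by linarith), ?_⟩
    have := hA.dist_through_axis hX hK hQA hp h12 (by linarith)
    linarith [dist_nonneg (x := k₁ • h ^ Q • o) (y := (k₁ * (h ^ Q * f ^ n)) • o)]
  induction w with
  | nil =>
    intro p _ hp
    have h1 := (inner [] p (fun q hq => by
      have := hp.1 q (by simpa [wordEval, lastGap, mul_smul] using hq)
      linarith)).1
    exact ⟨h1, dist_nonneg⟩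
  | cons x w ih =>
    obtain ⟨⟨i, j⟩, g⟩ := x
    intro p hw hp
    obtain ⟨hw1, hw2, hw3⟩ := hw
    obtain ⟨h1, h2⟩ := ih (i, j) hw1 hw2
    set k₁ := secondEntry f h Q a b h₀ w (i, j) with hk₁
    have hk₂ : wordEval (schottkyLetter f h Q a b) h₀ (((i, j), g) :: w) * f ^ (p.1 + 1 : ℕ) =
        k₁ * (h ^ Q * (f ^ (j + 1 : ℕ) * g * f ^ (p.1 + 1 : ℕ))) := by
      simp only [hk₁, secondEntry, wordEval, schottkyLetter, mul_assoc]
    have hi' := hC (p.1 + 1) (by have := p.1.2; omega)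
    have hj' := hC (j + 1) (by have := j.2; omega)
    have h12 : ∀ q ∈ closestPoints (cyclicOrbit o h)
        (k₁⁻¹ • (k₁ * (h ^ Q * (f ^ (j + 1 : ℕ) * g * f ^ (p.1 + 1 : ℕ)))) • o),
        dist (h ^ Q • o) q ≤ d := by
      rw [← mul_smul, inv_mul_cancel_left, mul_smul]
      apply projNear_pow_smul
      intro q hq
      -- Alignment of the previous letter with its gap ignores the next letter, whose first power of
      -- `f` moves the point by at most `C` and its projection by at most `C + 44 * K`: hence the
      -- value of `d`.
      obtain ⟨r, hr⟩ := hA.1 (f ^ (j + 1 : ℕ) • g • o)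
      have e1 := hw3 r hr
      have e2 := hA.dist_proj_le hX hK hr hq
      rw [mul_smul, mul_smul, dist_smul, dist_smul] at e2
      linarith [dist_triangle o r q]
    have h21 : ∀ q ∈ closestPoints (cyclicOrbit o h)
        ((k₁ * (h ^ Q * (f ^ (j + 1 : ℕ) * g * f ^ (p.1 + 1 : ℕ))))⁻¹ • k₁ • o),
        dist o q ≤ d := by
      intro q hq
      -- The gap does not record the exponent `j` of the previous letter, which is why the left
      -- condition covers all of them.
      have := hp.2 j q (by
        simpa only [lastGap, ← mul_smul, mul_inv_rev, mul_assoc, inv_mul_cancel, mul_one] using hq)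
      linarith
    have h3 := hA.proj_next_axis hX hK hoA hQA h1 h12 h21 (by linarith)
    have h4 := hA.dist_through_axis hX hK hQA h1 h12 (by linarith)
    rw [← hk₂] at h3 h4
    obtain ⟨h5, h6⟩ := inner _ p h3
    refine ⟨h5, ?_⟩
    have h7 : dist (k₁ • h ^ Q • o)
        ((wordEval (schottkyLetter f h Q a b) h₀ (((i, j), g) :: w) * f ^ (p.1 + 1 : ℕ)) • o) =
        dist o (f ^ (j + 1 : ℕ) • g • f ^ (p.1 + 1 : ℕ) • o) := by
      rw [hk₂]; simp only [mul_smul, dist_smul]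
    have h8 := dist_triangle4 (f ^ (j + 1 : ℕ) • o) o (f ^ (j + 1 : ℕ) • g • f ^ (p.1 + 1 : ℕ) • o)
      (f ^ (j + 1 : ℕ) • g • o)
    simp only [dist_smul] at h8
    rw [dist_comm _ o, dist_comm _ o] at h8
    simp only [gapLength]
    linarith

lemma gapLength_le_dist_wordEval (hX : IsGeodesicSpace X) (hK : 0 < K)
    (hA : IsContractingSet K (cyclicOrbit o h)) (hc : 0 ≤ c)
    (hf : ∀ m : ℤ, m ≠ 0 → ∀ x ∈ cyclicOrbit o h, ProjNear o h c (f ^ m • x)) {Q a b : ℕ}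
    {C d : ℝ} (hC : ∀ i ≤ a + b, dist o (f ^ i • o) ≤ C) (hC0 : 0 ≤ C)
    (hd : d = c + 44 * K + C + 44 * K)
    (hQ : 200 * K + 10 * d + 2 * C + 1 ≤ dist o (h ^ Q • o)) (h₀ : G)
    (w : List ((Fin a × Fin b) × G))
    (hw : IsAlignedWord (schottkyLeft o f h (c + 44 * K) Q a b)
      (schottkyRight o f h (c + 44 * K) a b) h₀ w) :
    gapLength o w ≤ dist o (wordEval (schottkyLetter f h Q a b) h₀ w • o) := by
  rcases w with _ | ⟨⟨⟨i, j⟩, g⟩, w⟩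
  · exact dist_nonneg
  obtain ⟨hw1, hw2, hw3⟩ := hw
  obtain ⟨h1, h2⟩ := secondEntry_spec hX hK hA hc hf hC hC0 hd hQ h₀ w (i, j) hw1 hw2
  set k₁ := secondEntry f h Q a b h₀ w (i, j) with hk₁
  have hk₂ : wordEval (schottkyLetter f h Q a b) h₀ (((i, j), g) :: w) =
      k₁ * (h ^ Q * (f ^ (j + 1 : ℕ) * g)) := by
    simp only [hk₁, secondEntry, wordEval, schottkyLetter, mul_assoc]
  have h12 : ∀ q ∈ closestPoints (cyclicOrbit o h)
      (k₁⁻¹ • (k₁ * (h ^ Q * (f ^ (j + 1 : ℕ) * g))) • o), dist (h ^ Q • o) q ≤ d := by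
    rw [← mul_smul, inv_mul_cancel_left, mul_smul]
    apply projNear_pow_smul
    intro q hq
    have := hw3 q (by rwa [mul_smul] at hq)
    linarith
  have hQA : h ^ Q • o ∈ cyclicOrbit o h := ⟨Q, by simp⟩
  have h4 := hA.dist_through_axis hX hK hQA h1 h12 (by linarith)
  rw [hk₂]
  simp only [mul_smul, dist_smul] at h4 ⊢
  have hj' := hC (j + 1) (by have := j.2; omega)
  have h8 := dist_triangle (f ^ (j + 1 : ℕ) • o) o (f ^ (j + 1 : ℕ) • g • o)
  simp only [dist_smul] at h8
  rw [dist_comm _ o] at h8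
  simp only [gapLength]
  linarith

/-- Existence of Schottky families. -/
theorem exists_isSchottky (hX : IsGeodesicSpace X) {g h : G} (hg : IsContractingIsometry o g)
    (hh : IsContractingIsometry o h) (hgh : AreIndependent o g h) {η : ℝ} (hη : 0 < η) :
    ∃ P Q a b : ℕ, 0 < a ∧ 0 < b ∧ ∃ left right,
      IsSchottky o η (schottkyLetter (g ^ P) h Q a b) left right := by
  obtain ⟨K₁, hK₁, hg1⟩ := hg
  obtain ⟨K₂, hK₂, hh1⟩ := hh
  set K := max K₁ K₂
  have hK : 0 < K := lt_max_of_lt_left hK₁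
  have hg' : IsContractingAxis K (fun n : ℤ => g ^ n • o) :=
    ⟨hg1.1.mono hK₁ (le_max_left _ _), hg1.2.mono (le_max_left _ _)⟩
  have hh' : IsContractingAxis K (fun n : ℤ => h ^ n • o) :=
    ⟨hh1.1.mono hK₂ (le_max_right _ _), hh1.2.mono (le_max_right _ _)⟩
  have hA : IsContractingSet K (cyclicOrbit o h) := hh'.2
  obtain ⟨c₀, P, hP⟩ := hgh.exists_pow_proj_bound o hX hK hg' hh'
  set c := max c₀ 0
  have hf : ∀ m : ℤ, m ≠ 0 → ∀ x ∈ cyclicOrbit o h, ProjNear o h c ((g ^ P) ^ m • x) :=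
    fun m hm x hx p hp => (hP m hm x hx p hp).trans (le_max_left _ _)
  -- The bad letters number at most `a` on the right and `(b + 1) b` on the left, out of `a b`: `b`
  -- is chosen first, then `a` much larger, and `Q` last because `C` and `d` depend on `a` and `b`.
  obtain ⟨b, hb⟩ := exists_nat_gt (1 / η)
  obtain ⟨a, ha⟩ := exists_nat_gt ((b + 1) / η)
  have hb0 : 0 < b := by
    have : (0 : ℝ) < b := lt_trans (by positivity) hb
    exact_mod_cast this
  have ha0 : 0 < a := by
    have : (0 : ℝ) < a := lt_trans (by positivity) ha
    exact_mod_cast this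
  rw [div_lt_iff₀ hη] at ha hb
  set C := ∑ i ∈ Finset.range (a + b + 1), dist o ((g ^ P) ^ i • o) with hCdef
  have hC : ∀ i ≤ a + b, dist o ((g ^ P) ^ i • o) ≤ C := fun i hi =>
    Finset.single_le_sum (f := fun i => dist o ((g ^ P) ^ i • o)) (fun _ _ => dist_nonneg)
      (Finset.mem_range.2 (by omega))
  have hC0 : 0 ≤ C := Finset.sum_nonneg fun _ _ => dist_nonneg
  set d := c + 44 * K + C + 44 * K
  obtain ⟨Q, hQ⟩ := exists_nat_gt ((200 * K + 10 * d + 2 * C + 1 + K) * K)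
  have hQ' : 200 * K + 10 * d + 2 * C + 1 ≤ dist o (h ^ Q • o) := by
    have h4 := (hh'.1 0 Q).1
    simp only [zpow_zero, one_smul, Int.cast_zero, zero_sub, abs_neg, zpow_natCast,
      Int.cast_natCast, Nat.abs_cast] at h4
    rw [← lt_div_iff₀ hK] at hQ
    linarith
  refine ⟨P, Q, a, b, ha0, hb0, schottkyLeft o (g ^ P) h (c + 44 * K) Q a b,
    schottkyRight o (g ^ P) h (c + 44 * K) a b, ?_, ?_, ?_⟩
  · intro k
    have := schottkyLeft_bad hX hK hA hf Q a b k
    have h2 : ((_ : ℕ) : ℝ) ≤ (((b + 1) * b : ℕ) : ℝ) := Nat.cast_le.2 this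
    refine h2.trans ?_
    simp only [Fintype.card_prod, Fintype.card_fin]
    push_cast
    nlinarith [(Nat.cast_pos.2 hb0 : (0 : ℝ) < b)]
  · intro k
    have := schottkyRight_bad hX hK hA hf a b k
    have h2 : ((_ : ℕ) : ℝ) ≤ ((a : ℕ) : ℝ) := Nat.cast_le.2 this
    refine h2.trans ?_
    simp only [Fintype.card_prod, Fintype.card_fin]
    push_cast
    nlinarith [(Nat.cast_pos.2 ha0 : (0 : ℝ) < a)]
  · intro h₀ w hw
    exact gapLength_le_dist_wordEval hX hK hA (le_max_right _ _) hf hC hC0 rfl hQ' h₀ w hw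

end Construction

/-! ### The potential that accounts for lost rewards -/

section Potential

/-- The exponential of minus the total reward. -/
noncomputable def rewardExp (t : ℝ) (l : List ℝ) : ℝ := Real.exp (-t * l.sum)

/-- The expectation of `rewardExp` when a geometric number of the most recent rewards is lost. -/
noncomputable def potential (t κ : ℝ) : List ℝ → ℝ
  | [] => 1
  | r :: l => (1 - κ) * rewardExp t (r :: l) + κ * potential t κ l

/-- The expectation of the potential after backtracking. -/
noncomputable def backtrackPotential (t κ θ : ℝ) : List ℝ → ℝ
  | [] => 1
  | _ :: l => (1 - θ) * potential t κ l + θ * backtrackPotential t κ θ l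

variable {t κ θ : ℝ} {l : List ℝ}

lemma rewardExp_pos : 0 < rewardExp t l := Real.exp_pos _

lemma rewardExp_cons (r : ℝ) : rewardExp t (r :: l) = Real.exp (-t * r) * rewardExp t l := by
  simp [rewardExp, ← Real.exp_add, mul_add]

lemma rewardExp_cons_le {r : ℝ} (ht : 0 ≤ t) (hr : 0 ≤ r) :
    rewardExp t (r :: l) ≤ rewardExp t l := by
  rw [rewardExp_cons]
  refine mul_le_of_le_one_left rewardExp_pos.le (Real.exp_le_one_iff.2 ?_)
  nlinarith

lemma rewardExp_le_potential (ht : 0 ≤ t) (hκ : 0 ≤ κ) (hl : ∀ r ∈ l, 0 ≤ r) :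
    rewardExp t l ≤ potential t κ l := by
  induction l with
  | nil => simp [rewardExp, potential]
  | cons r l ih =>
    have h1 := ih fun x hx => hl x (List.mem_cons_of_mem _ hx)
    have h2 := rewardExp_cons_le (l := l) ht (hl r List.mem_cons_self)
    simp only [potential]
    nlinarith

lemma potential_nonneg (ht : 0 ≤ t) (hκ : 0 ≤ κ) (hl : ∀ r ∈ l, 0 ≤ r) :
    0 ≤ potential t κ l := rewardExp_pos.le.trans (rewardExp_le_potential ht hκ hl)

lemma potential_cons_le (ht : 0 ≤ t) (hκ : 0 ≤ κ) (hκ' : κ ≤ 1) {r : ℝ} (hr : 0 ≤ r)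
    (hl : ∀ r ∈ l, 0 ≤ r) : potential t κ (r :: l) ≤ potential t κ l := by
  have h1 := rewardExp_le_potential ht hκ hl
  have h2 := rewardExp_cons_le (l := l) ht hr
  simp only [potential]
  nlinarith

lemma potential_le_backtrackPotential (ht : 0 ≤ t) (hκ : 0 ≤ κ) (hκ' : κ ≤ 1) (hθ : 0 ≤ θ)
    (hl : ∀ r ∈ l, 0 ≤ r) : potential t κ l ≤ backtrackPotential t κ θ l := by
  induction l with
  | nil => simp [potential, backtrackPotential]
  | cons r l ih =>
    have hl' : ∀ r ∈ l, 0 ≤ r := fun x hx => hl x (List.mem_cons_of_mem _ hx)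
    have h1 := ih hl'
    have h2 := potential_cons_le ht hκ hκ' (hl r List.mem_cons_self) hl'
    simp only [backtrackPotential]
    nlinarith

/-- Losing the latest reward costs `g - e`, of which the potential records the fraction `κ`. As `2θ
≤ κ`, further backtracking at rate `θ` costs at most `g - e` again, whence the factor `2 / κ`. -/
lemma backtrackPotential_le (ht : 0 ≤ t) (hκ : 0 < κ) (hθ : 0 ≤ θ) (hθκ : 2 * θ ≤ κ)
    (hl : ∀ r ∈ l, 0 ≤ r) : backtrackPotential t κ θ l ≤
      rewardExp t l + 2 / κ * (potential t κ l - rewardExp t l) := by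
  induction l with
  | nil => simp [rewardExp, potential, backtrackPotential]
  | cons r l ih =>
    have hl' : ∀ r ∈ l, 0 ≤ r := fun x hx => hl x (List.mem_cons_of_mem _ hx)
    have h1 := ih hl'
    have h2 := rewardExp_cons_le (l := l) ht (hl r List.mem_cons_self)
    have h3 := rewardExp_le_potential ht hκ.le hl'
    simp only [backtrackPotential, potential]
    set e := rewardExp t (r :: l)
    set e' := rewardExp t l
    set g := potential t κ l
    have h4 : 2 / κ * ((1 - κ) * e + κ * g - e) = 2 * (g - e) := by field_simp; ring
    rw [h4]
    have h5 : θ * backtrackPotential t κ θ l ≤ θ * (e' + 2 / κ * (g - e')) := by gcongr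
    have h6 : θ * (2 / κ) ≤ 1 := by
      rw [mul_div_assoc', div_le_one hκ]; linarith
    have h7 : θ * (e' + 2 / κ * (g - e')) = θ * e' + θ * (2 / κ) * (g - e') := by ring
    have h8 : θ * (2 / κ) * (g - e') ≤ 1 * (g - e') := by
      apply mul_le_mul_of_nonneg_right h6; linarith
    nlinarith

end Potential

/-! ### Chains of partially revealed letters, and backtracking -/

section Chain

variable {X G ι : Type*}

/-- A letter which is only known to belong to a finite set, and the gap after it. The letter may
carry a reward. -/
structure ChainLink (ι G : Type*) where
  letters : Finset ι
  gap : G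
  reward : Option ℝ

/-- The rightmost gap of a chain. -/
def chainGap (h₀ : G) : List (ChainLink ι G) → G
  | [] => h₀
  | l :: _ => l.gap

/-- The list of rewards of a chain. -/
def chainRewards (c : List (ChainLink ι G)) : List ℝ := c.filterMap ChainLink.reward

section Avg

variable [Mul G]

/-- The average of `F` over all the words that a chain describes. -/
noncomputable def chainAvg (s : ι → G) (h₀ : G) : List (ChainLink ι G) → (G → ℝ≥0∞) → ℝ≥0∞
  | [], F => F h₀
  | l :: c, F => chainAvg s h₀ c fun g =>
      (l.letters.card : ℝ≥0∞)⁻¹ * ∑ a ∈ l.letters, F (g * s a * l.gap)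

variable {s : ι → G} {h₀ : G}

lemma chainAvg_add (c : List (ChainLink ι G)) (F F' : G → ℝ≥0∞) :
    chainAvg s h₀ c (fun g => F g + F' g) = chainAvg s h₀ c F + chainAvg s h₀ c F' := by
  induction c generalizing F F' with
  | nil => rfl
  | cons l c ih => simp only [chainAvg, Finset.sum_add_distrib, mul_add, ih]

lemma chainAvg_const_mul (c : List (ChainLink ι G)) (x : ℝ≥0∞) (F : G → ℝ≥0∞) :
    chainAvg s h₀ c (fun g => x * F g) = x * chainAvg s h₀ c F := by
  induction c generalizing F with
  | nil => rfl
  | cons l c ih =>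
    simp only [chainAvg, ← ih, ← Finset.mul_sum]
    congr 1; ext g; ring

lemma chainAvg_zero (c : List (ChainLink ι G)) : chainAvg s h₀ c (fun _ => 0) = 0 := by
  induction c with
  | nil => rfl
  | cons l c ih => simpa [chainAvg] using ih

lemma chainAvg_sum {α : Type*} (c : List (ChainLink ι G)) (A : Finset α) (F : α → G → ℝ≥0∞) :
    chainAvg s h₀ c (fun g => ∑ a ∈ A, F a g) = ∑ a ∈ A, chainAvg s h₀ c (F a) := by
  classical
  induction A using Finset.induction_on with
  | empty => simpa using chainAvg_zero c
  | insert a A ha ih => simp only [Finset.sum_insert ha, chainAvg_add, ih]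

lemma chainAvg_lintegral {α : Type*} [MeasurableSpace α] {ν : Measure α}
    (c : List (ChainLink ι G)) (F : α → G → ℝ≥0∞) (hF : ∀ g, Measurable fun x => F x g) :
    chainAvg s h₀ c (fun g => ∫⁻ x, F x g ∂ν) = ∫⁻ x, chainAvg s h₀ c (F x) ∂ν := by
  induction c generalizing F with
  | nil => rfl
  | cons l c ih =>
    simp only [chainAvg]
    rw [← ih]
    · congr 1; ext g
      rw [lintegral_const_mul _ (Finset.measurable_sum _ fun a _ => hF _),
        lintegral_finsetSum _ fun a _ => hF _]
    · intro g
      exact (Finset.measurable_sum _ fun a _ => hF _).const_mul _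

lemma measurable_chainAvg {α : Type*} [MeasurableSpace α]
    (c : List (ChainLink ι G)) (F : α → G → ℝ≥0∞) (hF : ∀ g, Measurable fun x => F x g) :
    Measurable fun x => chainAvg s h₀ c (F x) := by
  induction c generalizing F with
  | nil => exact hF _
  | cons l c ih =>
    exact ih _ fun g => (Finset.measurable_sum _ fun a _ => hF _).const_mul _

end Avg

variable [MetricSpace X] [Group G] [MulAction G X]

/-- A chain is valid if all the words that it describes are aligned, and if the links which
carry a reward contain most of the letters. -/
def ChainValid [Fintype ι] (o : X) (η : ℝ) (left : G → ι → Prop) (right : ι → G → Prop) (h₀ : G) :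
    List (ChainLink ι G) → Prop
  | [] => True
  | l :: c => ChainValid o η left right h₀ c ∧ l.letters.Nonempty ∧
      (∀ a ∈ l.letters, left (chainGap h₀ c) a ∧ right a l.gap) ∧
      ∀ r, l.reward = some r → 0 ≤ r ∧ r ≤ 1 + dist o (l.gap • o) ∧
        (1 - 2 * η) * Fintype.card ι ≤ l.letters.card

variable [Fintype ι] {o : X} {η : ℝ} {s : ι → G} {left : G → ι → Prop} {right : ι → G → Prop}

lemma ChainValid.reward_nonneg {h₀ : G} {c : List (ChainLink ι G)}
    (hc : ChainValid o η left right h₀ c) : ∀ r ∈ chainRewards c, 0 ≤ r := by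
  induction c with
  | nil => simp [chainRewards]
  | cons l c ih =>
    intro r hr
    rw [chainRewards, List.mem_filterMap] at hr
    obtain ⟨x, hx, hxr⟩ := hr
    rcases List.mem_cons.1 hx with rfl | hx
    · exact (hc.2.2.2 r hxr).1
    · exact ih hc.1 r (List.mem_filterMap.2 ⟨x, hx, hxr⟩)

/-- The total reward of a valid chain bounds from below the displacement of all its words. -/
lemma IsSchottky.chainAvg_exp_le (hs : IsSchottky o η s left right) {t : ℝ} (ht : 0 ≤ t)
    {h₀ : G} {c : List (ChainLink ι G)} (hc : ChainValid o η left right h₀ c) :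
    chainAvg s h₀ c (fun g => ENNReal.ofReal (Real.exp (-t * dist o (g • o)))) ≤
      ENNReal.ofReal (rewardExp t (chainRewards c)) := by
  -- A bound valid for every word described by the chain passes to the average; `F` is general
  -- because removing a link replaces it by an average over that link.
  have key : ∀ (c : List (ChainLink ι G)) (F : G → ℝ≥0∞) (B : ℝ≥0∞),
      ChainValid o η left right h₀ c →
      (∀ w : List (ι × G), IsAlignedWord left right h₀ w → lastGap h₀ w = chainGap h₀ c →
        (chainRewards c).sum ≤ gapLength o w → F (wordEval s h₀ w) ≤ B) →
      chainAvg s h₀ c F ≤ B := by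
    intro c
    induction c with
    | nil =>
      intro F B _ h
      exact h [] trivial rfl (by simp [chainRewards, gapLength])
    | cons l c ih =>
      intro F B hc h
      refine ih _ _ hc.1 fun w hw hw1 hw2 => ?_
      have hle : ∑ a ∈ l.letters, F (wordEval s h₀ w * s a * l.gap) ≤ l.letters.card • B := by
        refine Finset.sum_le_card_nsmul _ _ _ fun a ha => ?_
        refine h ((a, l.gap) :: w) ⟨hw, ?_⟩ rfl ?_
        · rw [hw1]; exact hc.2.2.1 a ha
        · simp only [gapLength]
          rcases hr : l.reward with _ | r
          · have : chainRewards (l :: c) = chainRewards c := by simp [chainRewards, hr]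
            rw [this]; linarith [dist_nonneg (x := o) (y := l.gap • o)]
          · have : chainRewards (l :: c) = r :: chainRewards c := by simp [chainRewards, hr]
            rw [this, List.sum_cons]; linarith [(hc.2.2.2 r hr).2.1]
      calc _ ≤ (l.letters.card : ℝ≥0∞)⁻¹ * (l.letters.card • B) := by gcongr
        _ = B := by
          rw [nsmul_eq_mul, ← mul_assoc, ENNReal.inv_mul_cancel, one_mul]
          · simpa using hc.2.1.ne_empty
          · simp
  refine key c _ _ hc fun w hw _ hw2 => ENNReal.ofReal_le_ofReal (Real.exp_le_exp.2 ?_)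
  nlinarith [hs.length_le h₀ w hw]

lemma ENNReal.inv_mul_add_ofReal {n n₁ n₂ : ℕ} (hn : 0 < n) {x y : ℝ} (hx : 0 ≤ x)
    (hy : 0 ≤ y) : (n : ℝ≥0∞)⁻¹ * (n₁ * ENNReal.ofReal x + n₂ * ENNReal.ofReal y) =
      ENNReal.ofReal ((n₁ * x + n₂ * y) / n) := by
  rw [ENNReal.ofReal_div_of_pos (by positivity), ENNReal.ofReal_add (by positivity) (by positivity),
    ENNReal.ofReal_mul (by positivity), ENNReal.ofReal_mul (by positivity), ENNReal.ofReal_natCast,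
    ENNReal.ofReal_natCast, ENNReal.ofReal_natCast, div_eq_mul_inv, mul_comm]

lemma ENNReal.le_card_mul_of_inv_mul_le {α : Type*} {A : Finset α} (hA : A.Nonempty) {x y : ℝ≥0∞}
    (h : (A.card : ℝ≥0∞)⁻¹ * x ≤ y) : x ≤ A.card * y := by
  refine le_trans (le_of_eq ?_) (mul_le_mul_right h _)
  rw [← mul_assoc, ENNReal.mul_inv_cancel, one_mul]
  · simpa using hA.ne_empty
  · simp

variable {t κ C : ℝ} {F : G → ℝ≥0∞}

/-- Backtracking: multiplying a valid chain by an arbitrary group element. -/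
lemma IsSchottky.chainAvg_mul_le (hs : IsSchottky o η s left right) [Nonempty ι]
    (ht : 0 ≤ t) (hκ : 0 ≤ κ) (hκ' : κ ≤ 1) (hC : 0 ≤ C) (hη : 0 ≤ η) (hη' : 4 * η ≤ 1)
    (hF : ∀ h₀ c, ChainValid o η left right h₀ c →
      chainAvg s h₀ c F ≤ ENNReal.ofReal (C * potential t κ (chainRewards c)))
    {h₀ : G} {c : List (ChainLink ι G)} (hc : ChainValid o η left right h₀ c) (g : G) :
    chainAvg s h₀ c (fun x => F (x * g)) ≤
      ENNReal.ofReal (C * backtrackPotential t κ (2 * η) (chainRewards c)) := by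
  classical
  induction c generalizing g with
  | nil =>
    have := hF (h₀ * g) [] trivial
    simpa only [chainAvg, chainRewards, List.filterMap_nil, backtrackPotential, potential]
      using this
  | cons l c ih =>
    have hl := hc.1.reward_nonneg
    set A₁ := l.letters.filter fun a => right a (l.gap * g) with hA₁
    set A₂ := l.letters.filter fun a => ¬ right a (l.gap * g) with hA₂
    have hcard : A₁.card + A₂.card = l.letters.card := Finset.card_filter_add_card_filter_not _
    have hG := potential_nonneg (t := t) (κ := κ) ht hκ hl
    have hGR := potential_le_backtrackPotential (θ := 2 * η) ht hκ hκ' (by linarith) hl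
    set p := potential t κ (chainRewards c)
    set q := backtrackPotential t κ (2 * η) (chainRewards c)
    -- Letters still aligned with the enlarged gap: the link survives with letters restricted to
    -- `A₁`, but forfeits its reward, since `A₁` may be too small for later estimates.
    have h1 : chainAvg s h₀ c (fun x => ∑ a ∈ A₁, F (x * s a * (l.gap * g))) ≤
        A₁.card * ENNReal.ofReal (C * p) := by
      rcases A₁.eq_empty_or_nonempty with h | h
      · rw [h]; simp [chainAvg_zero]
      have h2 := hF h₀ (⟨A₁, l.gap * g, none⟩ :: c) ⟨hc.1, h, fun a ha =>
        ⟨(hc.2.2.1 a (Finset.mem_filter.1 ha).1).1, (Finset.mem_filter.1 ha).2⟩, by simp⟩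
      simp only [chainAvg, chainRewards, List.filterMap_cons_none] at h2
      rw [chainAvg_const_mul] at h2
      exact ENNReal.le_card_mul_of_inv_mul_le h h2
    -- Misaligned letters are revealed and absorbed into the factor on the right; the backtracking
    -- continues on `c`.
    have h2 : chainAvg s h₀ c (fun x => ∑ a ∈ A₂, F (x * s a * (l.gap * g))) ≤
        A₂.card * ENNReal.ofReal (C * q) := by
      rw [chainAvg_sum, ← nsmul_eq_mul]
      refine Finset.sum_le_card_nsmul _ _ _ fun a _ => ?_
      have := ih hc.1 (s a * (l.gap * g))
      simpa only [mul_assoc] using this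
    have hpos : 0 < l.letters.card := hc.2.1.card_pos
    have h3 : chainAvg s h₀ (l :: c) (fun x => F (x * g)) ≤
        ENNReal.ofReal ((A₁.card * (C * p) + A₂.card * (C * q)) / l.letters.card) := by
      rw [← ENNReal.inv_mul_add_ofReal hpos (by positivity)
        (mul_nonneg hC (hG.trans hGR))]
      simp only [chainAvg]
      rw [chainAvg_const_mul]
      gcongr
      refine le_trans (le_of_eq ?_) (add_le_add h1 h2)
      rw [← chainAvg_add]
      congr 1; ext x
      rw [Finset.sum_filter_add_sum_filter_not]
      simp only [mul_assoc]
    refine h3.trans (ENNReal.ofReal_le_ofReal ?_)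
    have hposR : (0 : ℝ) < l.letters.card := by exact_mod_cast hpos
    have hcardR : (A₁.card : ℝ) + A₂.card = l.letters.card := by exact_mod_cast hcard
    rw [div_le_iff₀ hposR]
    -- Without a reward, nothing bounds the proportion of bad letters, but nothing is lost either:
    -- `p ≤ q` suffices. With a reward, the bad proportion is at most `η / (1 - 2 * η) ≤ 2 * η`.
    rcases hr : l.reward with _ | r
    · have : chainRewards (l :: c) = chainRewards c := by simp [chainRewards, hr]
      rw [this]
      have h5 : (A₁.card : ℝ) * (C * p) ≤ A₁.card * (C * q) := by gcongr
      have h6 : C * q * l.letters.card = A₁.card * (C * q) + A₂.card * (C * q) := by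
        rw [← hcardR]; ring
      linarith
    · have : chainRewards (l :: c) = r :: chainRewards c := by simp [chainRewards, hr]
      rw [this]
      simp only [backtrackPotential]
      have hbad : (A₂.card : ℝ) ≤ η * Fintype.card ι := by
        refine le_trans ?_ (hs.right_bad (l.gap * g))
        exact_mod_cast Finset.card_le_card fun a ha => Finset.mem_filter.2
          ⟨Finset.mem_univ _, (Finset.mem_filter.1 ha).2⟩
      have hbig := (hc.2.2.2 r hr).2.2
      have hfrac : (A₂.card : ℝ) ≤ 2 * η * l.letters.card := by
        have : (0 : ℝ) ≤ Fintype.card ι := Nat.cast_nonneg _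
        nlinarith [mul_nonneg hη this]
      have h6 : (A₁.card * (C * p) + A₂.card * (C * q)) =
          C * (l.letters.card * p + A₂.card * (q - p)) := by
        rw [← hcardR]; ring
      have h7 : (A₂.card : ℝ) * (q - p) ≤ 2 * η * l.letters.card * (q - p) := by
        apply mul_le_mul_of_nonneg_right hfrac; linarith
      rw [h6]
      calc C * (l.letters.card * p + A₂.card * (q - p))
          ≤ C * (l.letters.card * p + 2 * η * l.letters.card * (q - p)) := by gcongr
        _ = _ := by change _ = C * ((1 - 2 * η) * p + 2 * η * q) * _; ring

/-- Multiplying a valid chain by a random letter and a given gap. -/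
lemma IsSchottky.avg_chainAvg_le (hs : IsSchottky o η s left right) [Nonempty ι]
    (ht : 0 ≤ t) (hκ : 0 < κ) (hκ' : κ ≤ 1) (hC : 0 ≤ C) (hη : 0 ≤ η) (hη' : 4 * η ≤ κ)
    (hF : ∀ h₀ c, ChainValid o η left right h₀ c →
      chainAvg s h₀ c F ≤ ENNReal.ofReal (C * potential t κ (chainRewards c)))
    {h₀ : G} {c : List (ChainLink ι G)} (hc : ChainValid o η left right h₀ c) (g : G) {r : ℝ}
    (hr : 0 ≤ r) (hrg : r ≤ 1 + dist o (g • o)) :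
    (Fintype.card ι : ℝ≥0∞)⁻¹ * ∑ a, chainAvg s h₀ c (fun x => F (x * s a * g)) ≤
      ENNReal.ofReal (C * ((1 - 2 * η) * potential t κ (r :: chainRewards c) +
        2 * η * (rewardExp t (chainRewards c) +
          2 / κ * (potential t κ (chainRewards c) - rewardExp t (chainRewards c))))) := by
  classical
  set A₁ := Finset.univ.filter fun a => left (chainGap h₀ c) a ∧ right a g with hA₁
  set A₂ := Finset.univ.filter fun a => ¬ (left (chainGap h₀ c) a ∧ right a g) with hA₂
  have hcard : A₁.card + A₂.card = Fintype.card ι := Finset.card_filter_add_card_filter_not _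
  have hl := hc.reward_nonneg
  have hG := potential_nonneg (t := t) (κ := κ) ht hκ.le hl
  have hG' : 0 ≤ potential t κ (r :: chainRewards c) := potential_nonneg ht hκ.le (by
    intro x hx
    rcases List.mem_cons.1 hx with rfl | hx
    exacts [hr, hl x hx])
  have hGG := potential_cons_le ht hκ.le hκ' hr hl
  have hGR := potential_le_backtrackPotential (θ := 2 * η) ht hκ.le hκ' (by linarith) hl
  have hR := backtrackPotential_le (θ := 2 * η) ht hκ (by linarith) (by linarith) hl
  set p := potential t κ (r :: chainRewards c)
  set q := backtrackPotential t κ (2 * η) (chainRewards c)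
  have hpos : 0 < Fintype.card ι := Fintype.card_pos
  have hposR : (0 : ℝ) < Fintype.card ι := by exact_mod_cast hpos
  have hcardR : (A₁.card : ℝ) + A₂.card = Fintype.card ι := by exact_mod_cast hcard
  have hbad : (A₂.card : ℝ) ≤ 2 * η * Fintype.card ι := by
    have hsub : A₂ ⊆ (Finset.univ.filter fun a => ¬ left (chainGap h₀ c) a) ∪
        (Finset.univ.filter fun a => ¬ right a g) := by
      intro a ha
      have := (Finset.mem_filter.1 ha).2
      rw [not_and_or] at this
      rcases this with h | h
      · exact Finset.mem_union_left _ (Finset.mem_filter.2 ⟨Finset.mem_univ _, h⟩)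
      · exact Finset.mem_union_right _ (Finset.mem_filter.2 ⟨Finset.mem_univ _, h⟩)
    have h1 : (A₂.card : ℝ) ≤ (Finset.univ.filter fun a => ¬ left (chainGap h₀ c) a).card +
        (Finset.univ.filter fun a => ¬ right a g).card := by
      exact_mod_cast (Finset.card_le_card hsub).trans (Finset.card_union_le _ _)
    linarith [hs.left_bad (chainGap h₀ c), hs.right_bad g]
  have h1 : ∑ a ∈ A₁, chainAvg s h₀ c (fun x => F (x * s a * g)) ≤
      A₁.card * ENNReal.ofReal (C * p) := by
    rcases A₁.eq_empty_or_nonempty with h | h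
    · rw [h]; simp
    -- At most a proportion `η` of the letters is excluded on each side, so the new link is large
    -- enough to carry the reward `r`.
    have h2 := hF h₀ (⟨A₁, g, some r⟩ :: c) ⟨hc, h, fun a ha => (Finset.mem_filter.1 ha).2, by
      intro r' hr'
      obtain rfl : r = r' := by simpa using hr'
      exact ⟨hr, hrg, by simp only; linarith⟩⟩
    have h3 : chainRewards (⟨A₁, g, some r⟩ :: c) = r :: chainRewards c := by
      simp [chainRewards]
    rw [h3] at h2
    simp only [chainAvg] at h2
    rw [chainAvg_const_mul, chainAvg_sum] at h2
    exact ENNReal.le_card_mul_of_inv_mul_le h h2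
  have h2 : ∑ a ∈ A₂, chainAvg s h₀ c (fun x => F (x * s a * g)) ≤
      A₂.card * ENNReal.ofReal (C * q) := by
    rw [← nsmul_eq_mul]
    refine Finset.sum_le_card_nsmul _ _ _ fun a _ => ?_
    have := hs.chainAvg_mul_le ht hκ.le hκ' hC hη (by linarith) hF hc (s a * g)
    simpa only [mul_assoc] using this
  calc _ = (Fintype.card ι : ℝ≥0∞)⁻¹ *
        (∑ a ∈ A₁, chainAvg s h₀ c (fun x => F (x * s a * g)) +
          ∑ a ∈ A₂, chainAvg s h₀ c (fun x => F (x * s a * g))) := by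
        rw [Finset.sum_filter_add_sum_filter_not]
    _ ≤ (Fintype.card ι : ℝ≥0∞)⁻¹ *
        (A₁.card * ENNReal.ofReal (C * p) + A₂.card * ENNReal.ofReal (C * q)) := by gcongr
    _ = ENNReal.ofReal ((A₁.card * (C * p) + A₂.card * (C * q)) / Fintype.card ι) :=
        ENNReal.inv_mul_add_ofReal hpos (by positivity) (mul_nonneg hC (hG.trans hGR))
    _ ≤ ENNReal.ofReal (C * ((1 - 2 * η) * p + 2 * η * q)) := by
        refine ENNReal.ofReal_le_ofReal ?_
        rw [div_le_iff₀ hposR]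
        have h6 : (A₁.card * (C * p) + A₂.card * (C * q)) =
            C * (Fintype.card ι * p + A₂.card * (q - p)) := by
          rw [← hcardR]; ring
        have h7 : (A₂.card : ℝ) * (q - p) ≤ 2 * η * Fintype.card ι * (q - p) := by
          apply mul_le_mul_of_nonneg_right hbad; linarith
        rw [h6]
        calc C * (Fintype.card ι * p + A₂.card * (q - p))
            ≤ C * (Fintype.card ι * p + 2 * η * Fintype.card ι * (q - p)) := by gcongr
          _ = _ := by ring
    _ ≤ _ := by
        refine ENNReal.ofReal_le_ofReal ?_
        gcongr

end Chain

/-! ### Convolution powers and the elements they charge -/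

section ConvPow

set_option linter.unusedSectionVars false

variable {G : Type*} [Group G] [Countable G] [MeasurableSpace G] [DiscreteMeasurableSpace G]

/-- The law of the random walk at time `n`. -/
noncomputable def convPow (μ : Measure G) : ℕ → Measure G
  | 0 => Measure.dirac 1
  | n + 1 => convPow μ n ∗ₘ μ

variable (μ : Measure G) [IsProbabilityMeasure μ]

instance (n : ℕ) : IsProbabilityMeasure (convPow μ n) := by
  induction n with
  | zero => exact Measure.dirac.isProbabilityMeasure
  | succ n ih => exact Measure.probabilitymeasure_of_probabilitymeasures_mconv _ _

lemma convPow_one : convPow μ 1 = μ := Measure.dirac_one_mconv μ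

lemma convPow_add (m n : ℕ) : convPow μ (m + n) = convPow μ m ∗ₘ convPow μ n := by
  induction n with
  | zero => exact (Measure.mconv_dirac_one _).symm
  | succ n ih =>
    rw [← add_assoc, convPow, ih, Measure.mconv_assoc, convPow]

lemma lintegral_convPow_add (m n : ℕ) (F : G → ℝ≥0∞) :
    ∫⁻ g, F g ∂convPow μ (m + n) = ∫⁻ x, ∫⁻ y, F (x * y) ∂convPow μ n ∂convPow μ m := by
  rw [convPow_add, Measure.lintegral_mconv Measurable.of_discrete]

lemma convPow_mul_ne_zero {m n : ℕ} {x y : G} (hx : convPow μ m {x} ≠ 0)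
    (hy : convPow μ n {y} ≠ 0) : convPow μ (m + n) {x * y} ≠ 0 := by
  rw [← lintegral_indicator_one (measurableSet_singleton _), lintegral_convPow_add]
  intro h
  rw [lintegral_eq_zero_iff Measurable.of_discrete] at h
  have h1 := (ae_iff_of_countable.1 h) x hx
  simp only [Pi.zero_apply] at h1
  rw [lintegral_eq_zero_iff Measurable.of_discrete] at h1
  have h2 := (ae_iff_of_countable.1 h1) y hy
  simp at h2

lemma convPow_pow_ne_zero {m : ℕ} {x : G} (hx : convPow μ m {x} ≠ 0) (n : ℕ) :
    convPow μ (m * n) {x ^ n} ≠ 0 := by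
  induction n with
  | zero => simp [convPow]
  | succ n ih =>
    rw [mul_add, mul_one, pow_succ]
    exact convPow_mul_ne_zero μ ih hx

lemma exists_convPow_ne_zero {x : G} (hx : x ∈ Submonoid.closure (atomSupport μ)) :
    ∃ n, convPow μ n {x} ≠ 0 := by
  induction hx using Submonoid.closure_induction with
  | mem x hx => exact ⟨1, by rw [convPow_one]; exact hx⟩
  | one => exact ⟨0, by simp [convPow]⟩
  | mul x y _ _ hx hy =>
    obtain ⟨m, hm⟩ := hx
    obtain ⟨n, hn⟩ := hy
    exact ⟨m + n, convPow_mul_ne_zero μ hm hn⟩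

/-- The middle exponent compensates the outer ones, so all letters have the same numbers of factors
`f` and `h` and are charged by a single convolution power. -/
lemma convPow_schottkyLetter_ne_zero {f h : G} {p q : ℕ} (hf : convPow μ p {f} ≠ 0)
    (hh : convPow μ q {h} ≠ 0) (Q a b : ℕ) (i : Fin a × Fin b) :
    convPow μ (p * (a + b + 1) + 2 * (q * Q)) {schottkyLetter f h Q a b i} ≠ 0 := by
  have h1 := convPow_mul_ne_zero μ (convPow_mul_ne_zero μ (convPow_mul_ne_zero μ
    (convPow_mul_ne_zero μ (convPow_pow_ne_zero μ hf (i.1 + 1)) (convPow_pow_ne_zero μ hh Q))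
    (convPow_pow_ne_zero μ hf (a + b - 1 - i.1 - i.2))) (convPow_pow_ne_zero μ hh Q))
    (convPow_pow_ne_zero μ hf (i.2 + 1))
  have h2 : p * (a + b + 1) + 2 * (q * Q) = p * (i.1 + 1) + q * Q +
      p * (a + b - 1 - i.1 - i.2) + q * Q + p * (i.2 + 1) := by
    have h3 : a + b + 1 = (i.1 + 1) + (a + b - 1 - i.1 - i.2) + (i.2 + 1) := by
      have := i.1.2
      have := i.2.2
      omega
    rw [h3]; ring
  rw [h2]
  exact h1

end ConvPow

/-! ### Extracting a uniform Schottky letter from a convolution power -/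

section Decomposition

set_option linter.unusedSectionVars false

variable {G ι : Type*} [Group G] [Countable G] [MeasurableSpace G] [DiscreteMeasurableSpace G]
  [Fintype ι]

/-- The measure `ν` is the sum of the law of a product `u s v`, where `s` is uniformly distributed
and independent of `(u, v)`, with `(u, v)` distributed according to `τ`, and of a remainder `ζ`. -/
def IsDecomposition (s : ι → G) (ν : Measure G) (τ : Measure (G × G)) (ζ : Measure G) : Prop :=
  ∀ F : G → ℝ≥0∞, ∫⁻ g, F g ∂ν =
    ∫⁻ p, (Fintype.card ι : ℝ≥0∞)⁻¹ * ∑ a, F (p.1 * s a * p.2) ∂τ + ∫⁻ g, F g ∂ζ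

variable {s : ι → G} {ν : Measure G} {τ : Measure (G × G)} {ζ : Measure G}

lemma ENNReal.inv_card_mul_card [Nonempty ι] :
    (Fintype.card ι : ℝ≥0∞)⁻¹ * (Fintype.card ι : ℝ≥0∞) = 1 :=
  ENNReal.inv_mul_cancel (by simp) (by simp)

lemma IsDecomposition.mass [Nonempty ι] (h : IsDecomposition s ν τ ζ) :
    ν Set.univ = τ Set.univ + ζ Set.univ := by
  have := h fun _ => 1
  simpa [ENNReal.inv_card_mul_card] using this

lemma IsDecomposition.mconv [SFinite ζ] [SFinite τ] (h : IsDecomposition s ν τ ζ)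
    (ν' : Measure G) [SFinite ν'] :
    IsDecomposition s (ν ∗ₘ ν') ((τ.prod ν').map fun p => (p.1.1, p.1.2 * p.2)) (ζ ∗ₘ ν') := by
  intro F
  rw [Measure.lintegral_mconv_eq_lintegral_prod Measurable.of_discrete,
    Measure.lintegral_mconv Measurable.of_discrete,
    lintegral_map Measurable.of_discrete Measurable.of_discrete,
    lintegral_prod _ Measurable.of_discrete.aemeasurable,
    lintegral_prod _ Measurable.of_discrete.aemeasurable, h]
  congr 1
  refine lintegral_congr fun p => ?_
  rw [lintegral_const_mul _ Measurable.of_discrete,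
    lintegral_finsetSum _ fun _ _ => Measurable.of_discrete]
  simp only [mul_assoc]

/-- Splitting further the remainder of a decomposition. -/
lemma IsDecomposition.split [SFinite ζ] [SFinite τ] (h : IsDecomposition s ν τ ζ)
    {ν₁ ν₂ : Measure G} [SFinite ν₁] [SFinite ν₂] {α : ℝ≥0∞}
    (hν : ∀ F : G → ℝ≥0∞, ∫⁻ g, F g ∂ν₁ =
      α * ((Fintype.card ι : ℝ≥0∞)⁻¹ * ∑ a, F (s a)) + ∫⁻ g, F g ∂ν₂) :
    IsDecomposition s (ν ∗ₘ ν₁) ((τ.prod ν₁).map (fun p => (p.1.1, p.1.2 * p.2)) +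
      α • ζ.map fun x => (x, 1)) (ζ ∗ₘ ν₂) := by
  intro F
  rw [h.mconv ν₁ F, lintegral_add_measure, add_assoc]
  congr 1
  rw [lintegral_smul_measure, lintegral_map Measurable.of_discrete Measurable.of_discrete,
    Measure.lintegral_mconv Measurable.of_discrete, Measure.lintegral_mconv Measurable.of_discrete]
  simp only [hν]
  rw [lintegral_add_left Measurable.of_discrete, lintegral_const_mul _ Measurable.of_discrete]
  simp

open Classical in
lemma exists_minorization [Nonempty ι] (ν₁ : Measure G) [IsProbabilityMeasure ν₁]
    (hs : ∀ a, ν₁ {s a} ≠ 0) :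
    ∃ (α : ℝ≥0∞) (ν₂ : Measure G), α ≠ ∞ ∧ IsFiniteMeasure ν₂ ∧ ν₂ Set.univ < 1 ∧
      ∀ F : G → ℝ≥0∞, ∫⁻ g, F g ∂ν₁ =
        α * ((Fintype.card ι : ℝ≥0∞)⁻¹ * ∑ a, F (s a)) + ∫⁻ g, F g ∂ν₂ := by
  obtain ⟨a₀, -, ha₀⟩ := Finset.exists_min_image Finset.univ (fun a => ν₁ {s a})
    Finset.univ_nonempty
  -- The whole mass of `β` is at most that of any atom `s a`, so `β ≤ ν₁` holds even when `s` is not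
  -- injective.
  set α := ν₁ {s a₀}
  set β : Measure G := (α * (Fintype.card ι : ℝ≥0∞)⁻¹) • ∑ a, Measure.dirac (s a) with hβ
  have hβF : ∀ F : G → ℝ≥0∞, ∫⁻ g, F g ∂β =
      α * ((Fintype.card ι : ℝ≥0∞)⁻¹ * ∑ a, F (s a)) := by
    intro F
    rw [hβ, lintegral_smul_measure, lintegral_finsetSum_measure]
    simp [mul_assoc]
  have hα : α ≠ ∞ := measure_ne_top _ _
  have hβu : β Set.univ = α := by
    rw [← lintegral_one, hβF]
    simp [ENNReal.inv_card_mul_card]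
  have : IsFiniteMeasure β := ⟨by rw [hβu]; exact hα.lt_top⟩
  have hle : β ≤ ν₁ := by
    refine Measure.le_iff.2 fun B hB => ?_
    rw [← lintegral_indicator_one hB, hβF]
    by_cases hB' : ∃ a, s a ∈ B
    · obtain ⟨a, ha⟩ := hB'
      calc _ ≤ α * ((Fintype.card ι : ℝ≥0∞)⁻¹ * ∑ _a : ι, 1) := by
            gcongr with b
            exact Set.indicator_le_self' (by simp) _
        _ = α := by simp [ENNReal.inv_card_mul_card]
        _ ≤ ν₁ {s a} := ha₀ a (Finset.mem_univ _)
        _ ≤ ν₁ B := measure_mono (by simpa using ha)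
    · push Not at hB'
      simp [hB']
  have hsub : ν₁ - β + β = ν₁ := Measure.sub_add_cancel_of_le hle
  refine ⟨α, ν₁ - β, hα, inferInstance, ?_, fun F => ?_⟩
  · have h1 : (ν₁ - β) Set.univ + α = 1 := by
      rw [← hβu, ← Measure.add_apply, hsub, measure_univ]
    rw [← h1]
    exact ENNReal.lt_add_right (measure_ne_top _ _) (hs a₀)
  · conv_lhs => rw [← hsub]
    rw [lintegral_add_measure, hβF, add_comm]

/-- Among `Q` successive blocks of `M` steps, keep the first one that yields a uniform letter; all
of them fail with mass `(ν₂ univ) ^ Q`, which tends to `0`. -/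
lemma exists_decomposition_small [Nonempty ι] (μ : Measure G) [IsProbabilityMeasure μ] (M : ℕ)
    (hs : ∀ a, convPow μ M {s a} ≠ 0) {δ : ℝ≥0∞} (hδ : 0 < δ) :
    ∃ (R : ℕ) (τ : Measure (G × G)) (ζ : Measure G), 0 < R ∧ IsFiniteMeasure τ ∧
      IsFiniteMeasure ζ ∧ ζ Set.univ < δ ∧ IsDecomposition s (convPow μ R) τ ζ := by
  obtain ⟨α, ν₂, hα, hν₂, hν₂1, hν⟩ := exists_minorization (convPow μ M) hs
  have key : ∀ Q : ℕ, ∃ (τ : Measure (G × G)) (ζ : Measure G), IsFiniteMeasure τ ∧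
      IsFiniteMeasure ζ ∧ ζ Set.univ = ν₂ Set.univ ^ Q ∧
      IsDecomposition s (convPow μ (Q * M)) τ ζ := by
    intro Q
    induction Q with
    | zero =>
      refine ⟨0, Measure.dirac 1, inferInstance, inferInstance, by simp, ?_⟩
      intro F
      simp [convPow]
    | succ Q ih =>
      obtain ⟨τ, ζ, hτ, hζ, hm, hd⟩ := ih
      refine ⟨_, _, ?_, ?_, ?_, by rw [add_mul, one_mul, convPow_add]; exact hd.split hν⟩
      · have : IsFiniteMeasure (α • ζ.map fun x => (x, (1 : G))) :=
          Measure.smul_finite _ hα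
        infer_instance
      · infer_instance
      · rw [← lintegral_one, Measure.lintegral_mconv Measurable.of_discrete]
        simp [hm, pow_succ, mul_comm]
  obtain ⟨Q, hQ⟩ := (((ENNReal.tendsto_pow_atTop_nhds_zero_iff).2 hν₂1).eventually
    (gt_mem_nhds hδ)).exists
  obtain ⟨τ, ζ, hτ, hζ, hm, hd⟩ := key Q
  -- The extra step only serves to ensure `0 < R`.
  refine ⟨Q * M + 1, _, _, by omega, ?_, ?_, ?_, by
    rw [convPow_add]; exact hd.mconv (convPow μ 1)⟩
  · infer_instance
  · infer_instance
  · rw [← lintegral_one, Measure.lintegral_mconv Measurable.of_discrete]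
    simpa [hm] using hQ

variable {X : Type*} [MetricSpace X] [MulAction G X]

/-- Large powers of a measure which charges a given family `s` have a decomposition with small
remainder, and such that `u` and `v` are bounded. -/
lemma exists_decomposition [Nonempty ι] (o : X) (μ : Measure G) [IsProbabilityMeasure μ] (M : ℕ)
    (hs : ∀ a, convPow μ M {s a} ≠ 0) {δ : ℝ≥0∞} (hδ : 0 < δ) :
    ∃ (R : ℕ) (A : ℝ) (τ : Measure (G × G)) (ζ : Measure G), 0 < R ∧ IsFiniteMeasure τ ∧
      IsFiniteMeasure ζ ∧ ζ Set.univ < δ ∧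
      (∀ᵐ p ∂τ, dist o (p.1 • o) ≤ A ∧ dist o (p.2 • o) ≤ A) ∧
      IsDecomposition s (convPow μ R) τ ζ := by
  obtain ⟨R, τ, ζ, hR, hτ, hζ, hm, hd⟩ := exists_decomposition_small (s := s) μ M hs
    (ENNReal.half_pos hδ.ne')
  -- The part of `τ` where `u` or `v` is large is moved to the remainder, at a cost of `δ / 2`.
  set B : ℕ → Set (G × G) := fun n =>
    {p | ¬ (dist o (p.1 • o) ≤ n ∧ dist o (p.2 • o) ≤ n)} with hB
  have hBanti : Antitone B := by
    intro m n hmn p hp hp'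
    have : (m : ℝ) ≤ n := by exact_mod_cast hmn
    exact hp ⟨hp'.1.trans this, hp'.2.trans this⟩
  have hBinter : ⋂ n, B n = ∅ := by
    ext p
    simp only [Set.mem_iInter, Set.mem_empty_iff_false, iff_false, not_forall]
    obtain ⟨n, hn⟩ := exists_nat_ge (max (dist o (p.1 • o)) (dist o (p.2 • o)))
    exact ⟨n, fun h => h ⟨(le_max_left _ _).trans hn, (le_max_right _ _).trans hn⟩⟩
  have htend := tendsto_measure_iInter_atTop (μ := τ) (s := B)
    (fun n => (MeasurableSet.of_discrete).nullMeasurableSet) hBanti ⟨0, measure_ne_top _ _⟩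
  rw [hBinter, measure_empty] at htend
  obtain ⟨n, hn⟩ := (htend.eventually (gt_mem_nhds (ENNReal.half_pos hδ.ne'))).exists
  have hBm : MeasurableSet (B n) := MeasurableSet.of_discrete
  set ζ' : Measure G := (Fintype.card ι : ℝ≥0∞)⁻¹ •
    ∑ a, (τ.restrict (B n)).map fun p => p.1 * s a * p.2 with hζ'
  have hζ'F : ∀ F : G → ℝ≥0∞, ∫⁻ g, F g ∂ζ' =
      ∫⁻ p in B n, (Fintype.card ι : ℝ≥0∞)⁻¹ * ∑ a, F (p.1 * s a * p.2) ∂τ := by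
    intro F
    rw [hζ', lintegral_smul_measure, lintegral_finsetSum_measure,
      lintegral_const_mul _ Measurable.of_discrete,
      lintegral_finsetSum _ fun _ _ => Measurable.of_discrete, smul_eq_mul]
    congr 1
    refine Finset.sum_congr rfl fun a _ => ?_
    rw [lintegral_map Measurable.of_discrete Measurable.of_discrete]
  have hζ'u : ζ' Set.univ = τ (B n) := by
    rw [← lintegral_one, hζ'F]
    simp [ENNReal.inv_card_mul_card]
  have : IsFiniteMeasure ζ' := ⟨by rw [hζ'u]; exact measure_lt_top _ _⟩
  refine ⟨R, n, τ.restrict (B n)ᶜ, ζ + ζ', hR, inferInstance, inferInstance, ?_, ?_, fun F => ?_⟩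
  · rw [Measure.add_apply, hζ'u, ← ENNReal.add_halves δ]
    exact ENNReal.add_lt_add hm hn
  · rw [ae_restrict_iff' hBm.compl]
    refine Eventually.of_forall fun p hp => ?_
    simpa [hB] using hp
  · rw [hd F, lintegral_add_measure, hζ'F, ← lintegral_add_compl _ hBm]
    ring

end Decomposition

/-! ### Induction on blocks for the exponential moment -/

section Recursion

set_option linter.unusedSectionVars false

variable {X G ι : Type*} [MetricSpace X] [Group G] [MulAction G X] [Countable G]
  [MeasurableSpace G] [DiscreteMeasurableSpace G] [Fintype ι]

/-- The average of `F` over the words described by a chain, followed by a random letter and a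
fixed gap `g`. -/
noncomputable def pendingAvg (s : ι → G) (h₀ : G) (c : List (ChainLink ι G)) (g : G)
    (F : G → ℝ≥0∞) : ℝ≥0∞ :=
  (Fintype.card ι : ℝ≥0∞)⁻¹ * ∑ a, chainAvg s h₀ c fun x => F (x * s a * g)

/-- The average of `F (g s g')` over a random letter `s`. -/
noncomputable def letterAvg (s : ι → G) (g' : G) (F : G → ℝ≥0∞) (g : G) : ℝ≥0∞ :=
  (Fintype.card ι : ℝ≥0∞)⁻¹ * ∑ a, F (g * s a * g')

/-- The expectation of `exp (-t d(o, g w o))`, where `w` is distributed according to `ν`. -/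
noncomputable def expDisp (o : X) (t : ℝ) (ν : Measure G) (g : G) : ℝ≥0∞ :=
  ∫⁻ y, ENNReal.ofReal (Real.exp (-t * dist o ((g * y) • o))) ∂ν

variable {s : ι → G} {h₀ : G}

lemma chainAvg_letterAvg (c : List (ChainLink ι G)) (g : G) (F : G → ℝ≥0∞) :
    chainAvg s h₀ c (letterAvg s g F) = pendingAvg s h₀ c g F := by
  change chainAvg s h₀ c (fun x => _ * ∑ a, F (x * s a * g)) = _
  rw [chainAvg_const_mul, chainAvg_sum, pendingAvg]

lemma pendingAvg_add (c : List (ChainLink ι G)) (g : G) (F F' : G → ℝ≥0∞) :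
    pendingAvg s h₀ c g (fun x => F x + F' x) =
      pendingAvg s h₀ c g F + pendingAvg s h₀ c g F' := by
  simp only [pendingAvg, chainAvg_add, Finset.sum_add_distrib, mul_add]

lemma pendingAvg_lintegral {α : Type*} [MeasurableSpace α] {ν : Measure α}
    (c : List (ChainLink ι G)) (g : G) (F : α → G → ℝ≥0∞) (hF : ∀ g, Measurable fun x => F x g) :
    pendingAvg s h₀ c g (fun g => ∫⁻ x, F x g ∂ν) = ∫⁻ x, pendingAvg s h₀ c g (F x) ∂ν := by
  simp only [pendingAvg]
  rw [lintegral_const_mul _ (Finset.measurable_sum _ fun a _ => measurable_chainAvg c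
    (fun x y => F x (y * s a * g)) fun _ => hF _),
    lintegral_finsetSum _ fun a _ => measurable_chainAvg c (fun x y => F x (y * s a * g))
      fun _ => hF _]
  congr 1
  refine Finset.sum_congr rfl fun a _ => ?_
  rw [chainAvg_lintegral c (fun x y => F x (y * s a * g)) fun _ => hF _]

lemma pendingAvg_mul_right (c : List (ChainLink ι G)) (g x : G) (F : G → ℝ≥0∞) :
    pendingAvg s h₀ c g (fun y => F (y * x)) = pendingAvg s h₀ c (g * x) F := by
  simp only [pendingAvg, mul_assoc]

lemma pendingAvg_congr {c : List (ChainLink ι G)} {g : G} {F F' : G → ℝ≥0∞} (h : ∀ x, F x = F' x) :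
    pendingAvg s h₀ c g F = pendingAvg s h₀ c g F' := by
  rw [funext h]

variable {o : X} {η : ℝ} {left : G → ι → Prop} {right : ι → G → Prop}

lemma expDisp_add (μ : Measure G) [IsProbabilityMeasure μ] (t : ℝ) (m n : ℕ) (g : G) :
    expDisp o t (convPow μ (m + n)) g =
      ∫⁻ x, expDisp o t (convPow μ n) (g * x) ∂convPow μ m := by
  simp only [expDisp]
  rw [lintegral_convPow_add]
  simp only [mul_assoc]

/-- One block of the random walk: a free part with law `ν`, followed by a part which admits a
decomposition. -/
lemma IsDecomposition.lintegral_block {ν ν' ζ : Measure G} {τ : Measure (G × G)}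
    (hd : IsDecomposition s ν' τ ζ) (F : G → ℝ≥0∞) (g : G) :
    ∫⁻ x, ∫⁻ y, F (g * x * y) ∂ν' ∂ν =
      ∫⁻ x, (∫⁻ p, letterAvg s p.2 F (g * x * p.1) ∂τ + ∫⁻ y, F (g * x * y) ∂ζ) ∂ν := by
  refine lintegral_congr fun x => ?_
  rw [hd fun y => F (g * x * y)]
  simp only [letterAvg, mul_assoc]

lemma IsDecomposition.pendingAvg_block {ν ν' ζ : Measure G} {τ : Measure (G × G)}
    (hd : IsDecomposition s ν' τ ζ) (F : G → ℝ≥0∞) (c : List (ChainLink ι G)) (g : G) :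
    pendingAvg s h₀ c g (fun z => ∫⁻ x, ∫⁻ y, F (z * x * y) ∂ν' ∂ν) =
      ∫⁻ x, (∫⁻ p, pendingAvg s h₀ c (g * x * p.1) (letterAvg s p.2 F) ∂τ +
        ∫⁻ y, pendingAvg s h₀ c (g * x * y) F ∂ζ) ∂ν := by
  rw [pendingAvg_congr fun z => hd.lintegral_block F z,
    pendingAvg_lintegral _ _ (fun x z => ∫⁻ p, letterAvg s p.2 F (z * x * p.1) ∂τ +
      ∫⁻ y, F (z * x * y) ∂ζ) fun _ => Measurable.of_discrete]
  refine lintegral_congr fun x => ?_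
  rw [pendingAvg_add, pendingAvg_lintegral _ _ (fun (p : G × G) z => letterAvg s p.2 F (z * x * p.1))
    fun _ => Measurable.of_discrete, pendingAvg_lintegral _ _ (fun y z => F (z * x * y))
    fun _ => Measurable.of_discrete]
  congr 1
  · refine lintegral_congr fun p => ?_
    rw [← pendingAvg_mul_right, ← pendingAvg_mul_right]
  · refine lintegral_congr fun p => ?_
    rw [← pendingAvg_mul_right, ← pendingAvg_mul_right]

variable {t κ A ε δ C : ℝ} {ν ν' ζ : Measure G} {τ : Measure (G × G)} {F : G → ℝ≥0∞}

/-- Effect of one block on a valid chain followed by a pending letter. -/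
lemma IsSchottky.pendingAvg_block_le (hs : IsSchottky o η s left right) [Nonempty ι]
    [IsProbabilityMeasure ν] [IsFiniteMeasure ζ]
    (ht : 0 ≤ t) (hκ : 0 < κ) (hκ' : κ ≤ 1) (hC : 0 ≤ C) (hη : 0 ≤ η) (hη' : 4 * η ≤ κ)
    (hd : IsDecomposition s ν' τ ζ)
    (hτ : ∀ᵐ p ∂τ, dist o (p.1 • o) ≤ A ∧ dist o (p.2 • o) ≤ A)
    {C' : ℝ}
    (hF : ∀ h₀ c g, ChainValid o η left right h₀ c → dist o (g • o) ≤ A →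
      pendingAvg s h₀ c g F ≤ ENNReal.ofReal (C * potential t κ (chainRewards c)))
    (hF' : ∀ h₀ c g, ChainValid o η left right h₀ c →
      pendingAvg s h₀ c g F ≤ ENNReal.ofReal (C' * potential t κ (chainRewards c)))
    {c : List (ChainLink ι G)} (hc : ChainValid o η left right h₀ c) (g : G)
    {r : G → ℝ} (hr : ∀ x, 0 ≤ r x)
    (hrg : ∀ x u, dist o (u • o) ≤ A → r x ≤ 1 + dist o ((g * x * u) • o)) {ρ : ℝ} (hρ : 0 ≤ ρ)
    (hρr : ∫⁻ x, ENNReal.ofReal (Real.exp (-t * r x)) ∂ν ≤ ENNReal.ofReal ρ) {E P : ℝ}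
    (hE : rewardExp t (chainRewards c) = E) (hP : potential t κ (chainRewards c) = P) :
    pendingAvg s h₀ c g (fun z => ∫⁻ x, ∫⁻ y, F (z * x * y) ∂ν' ∂ν) ≤
      τ Set.univ * ENNReal.ofReal (C * ((1 - 2 * η) * ((1 - κ) * (ρ * E) + κ * P) +
        2 * η * (E + 2 / κ * (P - E)))) + ζ Set.univ * ENNReal.ofReal (C' * P) := by
  have hl := hc.reward_nonneg
  have hE0 : 0 ≤ E := hE ▸ rewardExp_pos.le
  have hEP : E ≤ P := hE ▸ hP ▸ rewardExp_le_potential ht hκ.le hl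
  rw [hd.pendingAvg_block]
  -- On the main part, the pending letter gets its final gap `g x u` and joins the chain with reward
  -- `r x`, or causes backtracking; the new letter becomes pending, followed by the bounded `v`.
  have h1 : ∀ x, ∫⁻ p, pendingAvg s h₀ c (g * x * p.1) (letterAvg s p.2 F) ∂τ ≤
      ENNReal.ofReal (C * ((1 - 2 * η) * ((1 - κ) * (Real.exp (-t * r x) * E) + κ * P) +
        2 * η * (E + 2 / κ * (P - E)))) * τ Set.univ := by
    intro x
    rw [← lintegral_const]
    refine lintegral_mono_ae ?_
    filter_upwards [hτ] with p hp
    have := hs.avg_chainAvg_le ht hκ hκ' hC hη hη' (F := letterAvg s p.2 F) (fun h₀ c hc => by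
      rw [chainAvg_letterAvg]; exact hF h₀ c p.2 hc hp.2) hc (g * x * p.1) (hr x)
      (hrg x p.1 hp.1)
    simp only [potential, rewardExp_cons, hE, hP] at this
    exact this
  -- On the remainder no letter appears: the pending gap just grows without control, and only the
  -- weaker bound `hF'` applies.
  have h2 : ∀ x, ∫⁻ y, pendingAvg s h₀ c (g * x * y) F ∂ζ ≤
      ENNReal.ofReal (C' * P) * ζ Set.univ := by
    intro x
    rw [← lintegral_const]
    refine lintegral_mono fun y => ?_
    rw [← hP]
    exact hF' h₀ c _ hc
  refine (lintegral_mono fun x => add_le_add (h1 x) (h2 x)).trans ?_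
  rw [lintegral_add_right _ Measurable.of_discrete, lintegral_const, measure_univ (μ := ν), mul_one,
    lintegral_mul_const _ Measurable.of_discrete, mul_comm (ENNReal.ofReal (C' * P)),
    mul_comm _ (τ Set.univ)]
  gcongr
  have hu : 0 ≤ C * ((1 - 2 * η) * (1 - κ) * E) := by
    have : 0 ≤ 1 - 2 * η := by linarith
    have : 0 ≤ 1 - κ := by linarith
    positivity
  have hv : 0 ≤ C * ((1 - 2 * η) * (κ * P) + 2 * η * (E + 2 / κ * (P - E))) := by
    have : 0 ≤ 1 - 2 * η := by linarith
    have : 0 ≤ P - E := by linarith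
    have : 0 ≤ P := by linarith
    positivity
  -- The bound is affine in `exp (-t * r x)`, so integration over `x` just replaces this quantity by
  -- `ρ`.
  have h3 : ∀ y : ℝ, C * ((1 - 2 * η) * ((1 - κ) * (y * E) + κ * P) +
        2 * η * (E + 2 / κ * (P - E))) = C * ((1 - 2 * η) * (1 - κ) * E) * y +
        C * ((1 - 2 * η) * (κ * P) + 2 * η * (E + 2 / κ * (P - E))) := by
    intro y; ring
  simp only [h3]
  rw [ENNReal.ofReal_add (by positivity) hv, ENNReal.ofReal_mul hu]
  calc _ = ∫⁻ x, (ENNReal.ofReal (C * ((1 - 2 * η) * (1 - κ) * E)) *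
        ENNReal.ofReal (Real.exp (-t * r x)) +
        ENNReal.ofReal (C * ((1 - 2 * η) * (κ * P) + 2 * η * (E + 2 / κ * (P - E))))) ∂ν := by
        refine lintegral_congr fun x => ?_
        rw [ENNReal.ofReal_add (mul_nonneg hu (Real.exp_pos _).le) hv, ENNReal.ofReal_mul hu]
    _ ≤ _ := by
        rw [lintegral_add_right _ measurable_const, lintegral_const, measure_univ, mul_one,
          lintegral_const_mul _ Measurable.of_discrete]
        gcongr

/-- As `x ≤ y`, the worst case is the largest weight `δ` on `y`. -/
lemma ENNReal.convex_le {a b : ℝ≥0∞} (hab : a + b = 1) {x y z δ : ℝ} (hx : 0 ≤ x)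
    (hxy : x ≤ y) (hb : b ≤ ENNReal.ofReal δ) (hδ : 0 ≤ δ) (h : (1 - δ) * x + δ * y ≤ z) :
    a * ENNReal.ofReal x + b * ENNReal.ofReal y ≤ ENNReal.ofReal z := by
  have hbt : b ≠ ∞ := ne_top_of_le_ne_top ENNReal.ofReal_ne_top hb
  have hat : a ≠ ∞ := ne_top_of_le_ne_top ENNReal.one_ne_top (hab ▸ le_self_add)
  have h1 : a.toReal + b.toReal = 1 := by
    rw [← ENNReal.toReal_add hat hbt, hab, ENNReal.toReal_one]
  have h2 : b.toReal ≤ δ := ENNReal.toReal_le_of_le_ofReal hδ hb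
  rw [← ENNReal.ofReal_toReal hat, ← ENNReal.ofReal_toReal hbt,
    ← ENNReal.ofReal_mul ENNReal.toReal_nonneg, ← ENNReal.ofReal_mul ENNReal.toReal_nonneg,
    ← ENNReal.ofReal_add (mul_nonneg ENNReal.toReal_nonneg hx)
      (mul_nonneg ENNReal.toReal_nonneg (hx.trans hxy))]
  refine ENNReal.ofReal_le_ofReal ?_
  nlinarith

lemma backtrack_coef_le (hκ : 0 < κ) (hκ' : κ ≤ 1 / 4) (hη : 0 ≤ η) (hη' : 8 * η ≤ κ ^ 2) :
    (1 - 2 * η) * κ + 2 * η * (2 / κ) ≤ 1 / 2 := by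
  have hb : 2 * η * (2 / κ) ≤ κ / 2 := by
    rw [mul_div_assoc', div_le_iff₀ hκ]; nlinarith
  nlinarith [mul_nonneg hη hκ.le]

lemma remainder_coef_le (hκ : 0 < κ) (hκ' : κ ≤ 1 / 4) (hη : 0 ≤ η) (hη' : 8 * η ≤ κ ^ 2)
    (hδ : 0 ≤ δ) (hδ' : δ ≤ 1 / 8) (hε' : ε ≤ 1 / 4) :
    (1 - δ) * ((1 - 2 * η) * κ + 2 * η * (2 / κ)) + δ * (1 + 2 * ε) ≤ 3 / 4 := by
  have h1 : (1 - δ) * ((1 - 2 * η) * κ + 2 * η * (2 / κ)) ≤ (1 - δ) * (1 / 2) :=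
    mul_le_mul_of_nonneg_left (backtrack_coef_le hκ hκ' hη hη') (by linarith)
  nlinarith

lemma contraction_factor_ge (hκ : 0 < κ) (hη : 0 ≤ η) (hδ : 0 ≤ δ) (hε : 0 ≤ ε) :
    1 - ε ≤ 1 - (1 - (2 * η + κ + 3 * δ)) * ε := by
  have : 0 ≤ (2 * η + κ + 3 * δ) * ε := by positivity
  linarith

/-- In terms of `E` and the excess `P - E`: the coefficient of `E` contracts thanks to the reward,
and that of the excess is at most `3 / 4`, below the contraction factor. -/
lemma rewarded_block_le (hκ : 0 < κ) (hκ' : κ ≤ 1 / 4) (hη : 0 ≤ η) (hη' : 8 * η ≤ κ ^ 2)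
    (hδ : 0 ≤ δ) (hδ' : δ ≤ 1 / 8) (hε : 0 ≤ ε) (hε' : ε ≤ 1 / 4) {E P : ℝ} (hE : 0 ≤ E)
    (hEP : E ≤ P) :
    (1 - δ) * ((1 - 2 * η) * ((1 - κ) * ((1 - ε) * E) + κ * P) +
        2 * η * (E + 2 / κ * (P - E))) + δ * ((1 + 2 * ε) * P) ≤
      (1 - (1 - (2 * η + κ + 3 * δ)) * ε) * P := by
  have hD := remainder_coef_le hκ hκ' hη hη' hδ hδ' hε'
  have hθ := contraction_factor_ge hκ hη hδ hε
  have e1 : (1 - δ) * ((1 - 2 * η) * ((1 - κ) * ((1 - ε) * E) + κ * P) +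
      2 * η * (E + 2 / κ * (P - E))) + δ * ((1 + 2 * ε) * P) =
      (1 - ε * ((1 - δ) * ((1 - 2 * η) * (1 - κ)) - 2 * δ)) * E +
      ((1 - δ) * ((1 - 2 * η) * κ + 2 * η * (2 / κ)) + δ * (1 + 2 * ε)) * (P - E) := by ring
  have e2 : 1 - ε * ((1 - δ) * ((1 - 2 * η) * (1 - κ)) - 2 * δ) =
      1 - (1 - (2 * η + κ + 3 * δ)) * ε -
        ε * (2 * η * κ * (1 - δ) + 2 * δ * η + δ * κ) := by ring
  have e3 : 0 ≤ ε * (2 * η * κ * (1 - δ) + 2 * δ * η + δ * κ) := by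
    have : 0 ≤ 1 - δ := by linarith
    positivity
  have e4 : (1 - ε * ((1 - δ) * ((1 - 2 * η) * (1 - κ)) - 2 * δ)) * E ≤
      (1 - (1 - (2 * η + κ + 3 * δ)) * ε) * E :=
    mul_le_mul_of_nonneg_right (by linarith) hE
  have e5 : ((1 - δ) * ((1 - 2 * η) * κ + 2 * η * (2 / κ)) + δ * (1 + 2 * ε)) * (P - E) ≤
      (1 - (1 - (2 * η + κ + 3 * δ)) * ε) * (P - E) :=
    mul_le_mul_of_nonneg_right (by linarith) (by linarith)
  rw [e1]
  linarith

/-- Without a reward, the contraction is financed by the prefactor: `1 + 2 * ε` on the right against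
`1 + 2 * δ * ε` for the term `E` on the left. -/
lemma unrewarded_block_le (hκ : 0 < κ) (hκ' : κ ≤ 1 / 4) (hη : 0 ≤ η) (hη' : 8 * η ≤ κ ^ 2)
    (hδ : 0 ≤ δ) (hδ' : δ ≤ 1 / 8) (hε : 0 ≤ ε) (hε' : ε ≤ 1 / 4) {E P : ℝ} (hE : 0 ≤ E)
    (hEP : E ≤ P) :
    (1 - δ) * ((1 - 2 * η) * ((1 - κ) * (1 * E) + κ * P) +
        2 * η * (E + 2 / κ * (P - E))) + δ * ((1 + 2 * ε) * P) ≤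
      (1 - (1 - (2 * η + κ + 3 * δ)) * ε) * ((1 + 2 * ε) * P) := by
  have hD := remainder_coef_le hκ hκ' hη hη' hδ hδ' hε'
  have hθ := contraction_factor_ge hκ hη hδ hε
  set θ := 1 - (1 - (2 * η + κ + 3 * δ)) * ε
  have e1 : (1 - δ) * ((1 - 2 * η) * ((1 - κ) * (1 * E) + κ * P) +
      2 * η * (E + 2 / κ * (P - E))) + δ * ((1 + 2 * ε) * P) = (1 + 2 * δ * ε) * E +
      ((1 - δ) * ((1 - 2 * η) * κ + 2 * η * (2 / κ)) + δ * (1 + 2 * ε)) * (P - E) := by ring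
  have e3 : 1 + 2 * δ * ε ≤ θ * (1 + 2 * ε) := by
    have : (1 - ε) * (1 + 2 * ε) ≤ θ * (1 + 2 * ε) := by gcongr
    nlinarith
  have e4 : (1 + 2 * δ * ε) * E ≤ θ * (1 + 2 * ε) * E := mul_le_mul_of_nonneg_right e3 hE
  have e6 : 3 / 4 ≤ θ * (1 + 2 * ε) := by nlinarith
  have e5 : ((1 - δ) * ((1 - 2 * η) * κ + 2 * η * (2 / κ)) + δ * (1 + 2 * ε)) * (P - E) ≤
      θ * (1 + 2 * ε) * (P - E) :=
    mul_le_mul_of_nonneg_right (by linarith) (by linarith)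
  rw [e1]
  linarith

/-- The exponential moment of the displacement, after `n` blocks. -/
lemma IsSchottky.pendingAvg_expDisp_le (hs : IsSchottky o η s left right) [Nonempty ι]
    {μ : Measure G} [IsProbabilityMeasure μ] [IsFiniteMeasure ζ] {N R : ℕ}
    (ht : 0 ≤ t) (hκ : 0 < κ) (hκ' : κ ≤ 1 / 4) (hη : 0 ≤ η) (hη' : 8 * η ≤ κ ^ 2)
    (hδ : 0 ≤ δ) (hδ' : δ ≤ 1 / 8) (hε : 0 ≤ ε) (hε' : ε ≤ 1 / 4)
    (hd : IsDecomposition s (convPow μ R) τ ζ) (hζ : ζ Set.univ ≤ ENNReal.ofReal δ)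
    (hτ : ∀ᵐ p ∂τ, dist o (p.1 • o) ≤ A ∧ dist o (p.2 • o) ≤ A)
    {r : G → ℝ} (hr : ∀ x, 0 ≤ r x)
    (hrg : ∀ g x u, dist o (g • o) ≤ A → dist o (u • o) ≤ A →
      r x ≤ 1 + dist o ((g * x * u) • o))
    (hρr : ∫⁻ x, ENNReal.ofReal (Real.exp (-t * r x)) ∂(convPow μ N) ≤ ENNReal.ofReal (1 - ε))
    (m n : ℕ) (h₀ : G) (c : List (ChainLink ι G)) (g : G) (hc : ChainValid o η left right h₀ c) :
    (dist o (g • o) ≤ A → pendingAvg s h₀ c g (expDisp o t (convPow μ (n * (N + R) + m))) ≤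
      ENNReal.ofReal ((1 - (1 - (2 * η + κ + 3 * δ)) * ε) ^ n *
        potential t κ (chainRewards c))) ∧
    pendingAvg s h₀ c g (expDisp o t (convPow μ (n * (N + R) + m))) ≤
      ENNReal.ofReal ((1 + 2 * ε) * (1 - (1 - (2 * η + κ + 3 * δ)) * ε) ^ n *
        potential t κ (chainRewards c)) := by
  set θ := 1 - (1 - (2 * η + κ + 3 * δ)) * ε with hθ
  have hη4 : 4 * η ≤ κ / 8 := by nlinarith
  have hθ1 : 3 / 4 ≤ θ := by linarith [contraction_factor_ge hκ hη hδ hε]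
  induction n generalizing h₀ c g with
  | zero =>
    have hl := hc.reward_nonneg
    have hEP := rewardExp_le_potential ht hκ.le hl
    have hE0 := rewardExp_pos (t := t) (l := chainRewards c)
    have key : pendingAvg s h₀ c g (expDisp o t (convPow μ (0 * (N + R) + m))) ≤
        ENNReal.ofReal (potential t κ (chainRewards c)) := by
      change pendingAvg s h₀ c g (fun z => ∫⁻ y, ENNReal.ofReal (Real.exp (-t * dist o ((z * y) • o)))
        ∂convPow μ (0 * (N + R) + m)) ≤ _
      rw [pendingAvg_lintegral _ _ (fun y z => ENNReal.ofReal (Real.exp (-t * dist o ((z * y) • o))))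
        fun _ => Measurable.of_discrete]
      refine (lintegral_mono (g := fun _ => ENNReal.ofReal (potential t κ (chainRewards c)))
        fun y => ?_).trans (by simp)
      rw [pendingAvg_mul_right c g y fun z => ENNReal.ofReal (Real.exp (-t * dist o (z • o)))]
      have h1 := hs.avg_chainAvg_le ht hκ (by linarith) zero_le_one hη (by linarith)
        (F := fun z => ENNReal.ofReal (Real.exp (-t * dist o (z • o)))) (fun h₀ c hc =>
          (hs.chainAvg_exp_le ht hc).trans (ENNReal.ofReal_le_ofReal (by
            rw [one_mul]; exact rewardExp_le_potential ht hκ.le hc.reward_nonneg))) hc (g * y)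
        le_rfl (by positivity)
      refine h1.trans (ENNReal.ofReal_le_ofReal ?_)
      simp only [potential, rewardExp_cons, mul_zero, Real.exp_zero, one_mul]
      set E := rewardExp t (chainRewards c)
      set P := potential t κ (chainRewards c)
      have e1 : (1 - 2 * η) * ((1 - κ) * E + κ * P) + 2 * η * (E + 2 / κ * (P - E)) =
          E + ((1 - 2 * η) * κ + 2 * η * (2 / κ)) * (P - E) := by ring
      rw [e1]
      have e2 := backtrack_coef_le hκ hκ' hη hη'
      have e3 : ((1 - 2 * η) * κ + 2 * η * (2 / κ)) * (P - E) ≤ 1 / 2 * (P - E) :=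
        mul_le_mul_of_nonneg_right e2 (by linarith)
      linarith
    refine ⟨fun _ => by simpa using key, key.trans (ENNReal.ofReal_le_ofReal ?_)⟩
    rw [pow_zero, mul_one]
    nlinarith
  | succ n ih =>
    have hl := hc.reward_nonneg
    have hEP := rewardExp_le_potential ht hκ.le hl
    have hE0 := rewardExp_pos (t := t) (l := chainRewards c)
    have hblock : ∀ z, expDisp o t (convPow μ ((n + 1) * (N + R) + m)) z =
        ∫⁻ x, ∫⁻ y, expDisp o t (convPow μ (n * (N + R) + m)) (z * x * y) ∂convPow μ R
          ∂convPow μ N := by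
      intro z
      have : (n + 1) * (N + R) + m = N + (R + (n * (N + R) + m)) := by ring
      rw [this, expDisp_add]
      refine lintegral_congr fun x => ?_
      rw [expDisp_add]
    rw [pendingAvg_congr hblock]
    have hmass : τ Set.univ + ζ Set.univ = 1 := by rw [← hd.mass, measure_univ]
    set E := rewardExp t (chainRewards c) with hE
    set P := potential t κ (chainRewards c) with hP
    have hθn : 0 ≤ θ ^ n := pow_nonneg (by linarith) n
    have step : ∀ (r' : G → ℝ) (ρ : ℝ), (∀ x, 0 ≤ r' x) → 0 ≤ ρ → ρ ≤ 1 →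
        (∀ x u, dist o (u • o) ≤ A → r' x ≤ 1 + dist o ((g * x * u) • o)) →
        ∫⁻ x, ENNReal.ofReal (Real.exp (-t * r' x)) ∂(convPow μ N) ≤ ENNReal.ofReal ρ →
        ∀ D : ℝ, (1 - δ) * ((1 - 2 * η) * ((1 - κ) * (ρ * E) + κ * P) +
        2 * η * (E + 2 / κ * (P - E))) + δ * ((1 + 2 * ε) * P) ≤ D →
        pendingAvg s h₀ c g (fun z => ∫⁻ x, ∫⁻ y,
          expDisp o t (convPow μ (n * (N + R) + m)) (z * x * y) ∂convPow μ R ∂convPow μ N) ≤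
          ENNReal.ofReal (θ ^ n * D) := by
      intro r' ρ hr' hρ hρ1 hrg' hρr' D hD
      have h1 := hs.pendingAvg_block_le ht hκ (by linarith) hθn hη (by linarith) hd hτ
        (C' := (1 + 2 * ε) * θ ^ n)
        (fun h₀ c g hc => (ih h₀ c g hc).1) (fun h₀ c g hc => (ih h₀ c g hc).2) hc g hr' hrg'
        hρ hρr' hE.symm hP.symm
      refine h1.trans (ENNReal.convex_le hmass ?_ ?_ hζ hδ ?_)
      · have : 0 ≤ 1 - 2 * η := by linarith
        have : 0 ≤ 1 - κ := by linarith
        have : 0 ≤ P - E := by linarith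
        have : 0 ≤ P := by linarith
        positivity
      · have e1 : (1 - 2 * η) * ((1 - κ) * (ρ * E) + κ * P) + 2 * η * (E + 2 / κ * (P - E)) ≤
            (1 + 2 * ε) * P := by
          have h3 : (1 - 2 * η) * ((1 - κ) * (ρ * E) + κ * P) ≤
              (1 - 2 * η) * ((1 - κ) * E + κ * P) := by
            have : 0 ≤ 1 - 2 * η := by linarith
            have : 0 ≤ 1 - κ := by linarith
            gcongr
            nlinarith
          have h4 : (1 - 2 * η) * ((1 - κ) * E + κ * P) + 2 * η * (E + 2 / κ * (P - E)) =
            E + ((1 - 2 * η) * κ + 2 * η * (2 / κ)) * (P - E) := by ring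
          have e2 := backtrack_coef_le hκ hκ' hη hη'
          have e3 : ((1 - 2 * η) * κ + 2 * η * (2 / κ)) * (P - E) ≤ 1 / 2 * (P - E) :=
            mul_le_mul_of_nonneg_right e2 (by linarith)
          nlinarith [mul_nonneg hε (hE0.le.trans hEP)]
        calc _ ≤ θ ^ n * ((1 + 2 * ε) * P) := by gcongr
          _ = _ := by ring
      · calc _ = θ ^ n * ((1 - δ) * ((1 - 2 * η) * ((1 - κ) * (ρ * E) + κ * P) +
            2 * η * (E + 2 / κ * (P - E))) + δ * ((1 + 2 * ε) * P)) := by ring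
          _ ≤ _ := by gcongr
    constructor
    · intro hg
      have h1 := step r (1 - ε) hr (by linarith) (by linarith)
        (fun x u hu => hrg g x u hg hu) hρr (θ * P)
        (rewarded_block_le hκ hκ' hη hη' hδ hδ' hε hε' hE0.le hEP)
      refine h1.trans (le_of_eq ?_)
      congr 1; ring
    -- An uncontrolled pending gap earns the zero reward, for which `ρ = 1`.
    · have h1 := step (fun _ => 0) 1 (fun _ => le_rfl) zero_le_one le_rfl
        (fun x u hu => by positivity) (by simp) (θ * ((1 + 2 * ε) * P))
        (unrewarded_block_le hκ hκ' hη hη' hδ hδ' hε hε' hE0.le hEP)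
      refine h1.trans (le_of_eq ?_)
      congr 1; ring

/-- The first block that produces a letter starts an empty chain with a pending letter. Blocks
failing before that have mass at most `δ`, which the factor `2` absorbs since `1 + δ ≤ 2 * θ`. -/
lemma IsSchottky.expDisp_le (hs : IsSchottky o η s left right) [Nonempty ι]
    {μ : Measure G} [IsProbabilityMeasure μ] [IsFiniteMeasure ζ] {N R : ℕ}
    (ht : 0 ≤ t) (hκ : 0 < κ) (hκ' : κ ≤ 1 / 4) (hη : 0 ≤ η) (hη' : 8 * η ≤ κ ^ 2)
    (hδ : 0 ≤ δ) (hδ' : δ ≤ 1 / 8) (hε : 0 ≤ ε) (hε' : ε ≤ 1 / 4)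
    (hd : IsDecomposition s (convPow μ R) τ ζ) (hζ : ζ Set.univ ≤ ENNReal.ofReal δ)
    (hτ : ∀ᵐ p ∂τ, dist o (p.1 • o) ≤ A ∧ dist o (p.2 • o) ≤ A)
    {r : G → ℝ} (hr : ∀ x, 0 ≤ r x)
    (hrg : ∀ g x u, dist o (g • o) ≤ A → dist o (u • o) ≤ A →
      r x ≤ 1 + dist o ((g * x * u) • o))
    (hρr : ∫⁻ x, ENNReal.ofReal (Real.exp (-t * r x)) ∂(convPow μ N) ≤ ENNReal.ofReal (1 - ε))
    (m n : ℕ) (g : G) :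
    expDisp o t (convPow μ (n * (N + R) + m)) g ≤
      ENNReal.ofReal (2 * (1 - (1 - (2 * η + κ + 3 * δ)) * ε) ^ n) := by
  have hpend := fun n h₀ g => (hs.pendingAvg_expDisp_le ht hκ hκ' hη hη' hδ hδ' hε hε' hd hζ hτ hr
    hrg hρr m n h₀ [] g trivial).1
  set θ := 1 - (1 - (2 * η + κ + 3 * δ)) * ε with hθ
  have hθ1 : 3 / 4 ≤ θ := by linarith [contraction_factor_ge hκ hη hδ hε]
  induction n generalizing g with
  | zero =>
    calc _ ≤ ∫⁻ _, 1 ∂(convPow μ (0 * (N + R) + m)) := by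
          refine lintegral_mono fun y => ?_
          rw [← ENNReal.ofReal_one]
          refine ENNReal.ofReal_le_ofReal (Real.exp_le_one_iff.2 ?_)
          have := mul_nonneg ht (dist_nonneg (x := o) (y := (g * y) • o))
          linarith
      _ = ENNReal.ofReal 1 := by simp
      _ ≤ _ := ENNReal.ofReal_le_ofReal (by norm_num)
  | succ n ih =>
    have : (n + 1) * (N + R) + m = N + (R + (n * (N + R) + m)) := by ring
    rw [this, expDisp_add]
    simp only [expDisp_add μ t R]
    rw [hd.lintegral_block]
    have hθn : 0 ≤ θ ^ n := pow_nonneg (by linarith) n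
    have hmass : τ Set.univ + ζ Set.univ = 1 := by rw [← hd.mass, measure_univ]
    calc _ ≤ ∫⁻ _, (τ Set.univ * ENNReal.ofReal (θ ^ n) +
            ζ Set.univ * ENNReal.ofReal (2 * θ ^ n)) ∂convPow μ N := by
          refine lintegral_mono fun x => add_le_add ?_ ?_
          · rw [mul_comm (τ Set.univ), ← lintegral_const]
            refine lintegral_mono_ae ?_
            filter_upwards [hτ] with p hp
            have := hpend n (g * x * p.1) p.2 hp.2
            rw [← chainAvg_letterAvg] at this
            simpa [chainAvg, chainRewards, potential] using this
          · rw [mul_comm (ζ Set.univ), ← lintegral_const]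
            exact lintegral_mono fun y => ih _
      _ = τ Set.univ * ENNReal.ofReal (θ ^ n) + ζ Set.univ * ENNReal.ofReal (2 * θ ^ n) := by
          rw [lintegral_const, measure_univ (μ := convPow μ N), mul_one]
      _ ≤ _ := by
          refine ENNReal.convex_le hmass hθn (by linarith) hζ hδ ?_
          have : (1 - δ) + δ * 2 ≤ 2 * θ := by linarith
          calc _ = ((1 - δ) + δ * 2) * θ ^ n := by ring
            _ ≤ 2 * θ * θ ^ n := by gcongr
            _ = _ := by ring

end Recursion

/-! ### From exponential moments to exponential decay -/

section ExponentialBound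

set_option linter.unusedSectionVars false

variable {X G : Type*} [MetricSpace X] [Group G] [MulAction G X]
  [Countable G] [MeasurableSpace G] [DiscreteMeasurableSpace G]

/-- Markov inequality for the exponential moment of the displacement. -/
lemma measure_dist_le_expDisp (o : X) (ν : Measure G) {t : ℝ} (ht : 0 ≤ t) (a : ℝ) :
    ν {g | dist o (g • o) ≤ a} ≤ ENNReal.ofReal (Real.exp (t * a)) * expDisp o t ν 1 := by
  rw [← lintegral_indicator_one MeasurableSet.of_discrete, expDisp,
    ← lintegral_const_mul _ Measurable.of_discrete]
  refine lintegral_mono fun g => ?_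
  by_cases hg : dist o (g • o) ≤ a
  · rw [Set.indicator_of_mem (by exact hg), one_mul, ← ENNReal.ofReal_mul (Real.exp_pos _).le,
      ← Real.exp_add, Pi.one_apply, ← ENNReal.ofReal_one]
    refine ENNReal.ofReal_le_ofReal (Real.one_le_exp ?_)
    nlinarith
  · rw [Set.indicator_of_notMem (by exact hg)]
    exact zero_le

/-- Exponential moments with small parameter of a bounded function. -/
lemma exists_exp_moment_le {ν : Measure G} [IsProbabilityMeasure ν] {T : ℝ} {r : G → ℝ}
    (hr : ∀ x, 0 ≤ r x) (hrT : ∀ x, r x ≤ T) {d γ : ℝ} (hγ : 0 < γ)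
    (hd : d < γ * ∫ x, r x ∂ν) :
    ∃ t ε : ℝ, 0 < t ∧ 0 ≤ ε ∧ ε ≤ 1 / 4 ∧ t * d < γ * ε ∧
      ∫⁻ x, ENNReal.ofReal (Real.exp (-t * r x)) ∂ν ≤ ENNReal.ofReal (1 - ε) := by
  set T' := max T 1
  have hT' : 0 < T' := lt_max_of_lt_right one_pos
  have hrT' : ∀ x, r x ≤ T' := fun x => (hrT x).trans (le_max_left _ _)
  set J := ∫ x, r x ∂ν
  set e := γ * J - d with he
  have he0 : 0 < e := by linarith
  -- The first term keeps `1 - ρ ≤ 1 / 4`. The second keeps the quadratic error in `exp (-y) ≤ 1 - y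
  -- + y ^ 2` below half of the available margin `e`.
  set t := min (1 / (4 * T')) (e / (2 * γ * T' ^ 2)) with htdef
  have ht : 0 < t := lt_min (by positivity) (by positivity)
  have ht1 : t * T' ≤ 1 / 4 := by
    have : t ≤ 1 / (4 * T') := min_le_left _ _
    calc t * T' ≤ 1 / (4 * T') * T' := by gcongr
      _ = 1 / 4 := by field_simp
  have ht2 : γ * t * T' ^ 2 ≤ e / 2 := by
    have : t ≤ e / (2 * γ * T' ^ 2) := min_le_right _ _
    calc γ * t * T' ^ 2 ≤ γ * (e / (2 * γ * T' ^ 2)) * T' ^ 2 := by gcongr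
      _ = e / 2 := by field_simp
  have hbound : ∀ x, ‖Real.exp (-t * r x)‖ ≤ 1 := by
    intro x
    rw [Real.norm_of_nonneg (Real.exp_pos _).le]
    exact Real.exp_le_one_iff.2 (by nlinarith [hr x])
  have hint : Integrable (fun x => Real.exp (-t * r x)) ν :=
    Integrable.of_bound Measurable.of_discrete.aestronglyMeasurable 1
      (Eventually.of_forall hbound)
  have hintr : Integrable r ν :=
    Integrable.of_bound Measurable.of_discrete.aestronglyMeasurable T'
      (Eventually.of_forall fun x => by rw [Real.norm_of_nonneg (hr x)]; exact hrT' x)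
  set ρ := ∫ x, Real.exp (-t * r x) ∂ν with hρ
  have hρ1 : ρ ≤ 1 - t * J + t ^ 2 * T' ^ 2 := by
    have h1 : ∀ x, Real.exp (-t * r x) ≤ 1 - t * r x + t ^ 2 * T' ^ 2 := by
      intro x
      have hy : 0 ≤ t * r x := mul_nonneg ht.le (hr x)
      have h2 : Real.exp (-t * r x) ≤ 1 / (1 + t * r x) := by
        rw [neg_mul, Real.exp_neg, ← one_div]
        apply one_div_le_one_div_of_le (by linarith)
        linarith [Real.add_one_le_exp (t * r x)]
      have h3 : 1 / (1 + t * r x) ≤ 1 - t * r x + (t * r x) ^ 2 := by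
        rw [div_le_iff₀ (by linarith)]
        nlinarith [pow_nonneg hy 3]
      have h4 : (t * r x) ^ 2 ≤ t ^ 2 * T' ^ 2 := by
        rw [← mul_pow]
        have := hrT' x
        gcongr
      linarith
    calc ρ ≤ ∫ x, (1 - t * r x + t ^ 2 * T' ^ 2) ∂ν := by
          refine integral_mono hint ?_ h1
          exact ((integrable_const _).sub (hintr.const_mul t)).add (integrable_const _)
      _ = _ := by
          have hi : Integrable (fun x => 1 - t * r x) ν :=
            (integrable_const _).sub (hintr.const_mul t)
          rw [integral_add hi (integrable_const _), integral_sub (integrable_const _)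
            (hintr.const_mul t), integral_const_mul]
          simp [J]
  have hρ2 : 3 / 4 ≤ ρ := by
    have h1 : ∀ x, 3 / 4 ≤ Real.exp (-t * r x) := by
      intro x
      have : t * r x ≤ t * T' := by have := hrT' x; gcongr
      linarith [Real.add_one_le_exp (-t * r x)]
    calc (3 / 4 : ℝ) = ∫ _, 3 / 4 ∂ν := by simp
      _ ≤ ρ := integral_mono (integrable_const _) hint h1
  have hρ3 : ρ ≤ 1 := by
    calc ρ ≤ ∫ _, 1 ∂ν := integral_mono hint (integrable_const _) fun x => by
          have := hbound x
          rwa [Real.norm_of_nonneg (Real.exp_pos _).le] at this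
      _ = 1 := by simp
  refine ⟨t, 1 - ρ, ht, by linarith, by linarith, ?_, ?_⟩
  · have h1 : γ * (t * J - t ^ 2 * T' ^ 2) ≤ γ * (1 - ρ) :=
      mul_le_mul_of_nonneg_left (by linarith) hγ.le
    have h2 : t * (γ * t * T' ^ 2) ≤ t * (e / 2) := by gcongr
    have h3 : 0 < t * e := mul_pos ht he0
    have h4 : t * e = t * γ * J - t * d := by rw [he]; ring
    nlinarith
  · rw [sub_sub_cancel, hρ, ofReal_integral_eq_lintegral_ofReal hint
      (Eventually.of_forall fun x => (Real.exp_pos _).le)]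

lemma exists_exp_decay {B : ℕ} (hB : 0 < B) {ω c : ℝ} (hω : 0 < ω) :
    ∃ K : ℝ, 0 < K ∧ ∀ m : ℕ,
      2 * Real.exp (c - ω * (m / B : ℕ)) ≤ K * Real.exp (-m / K) := by
  have hB' : (0 : ℝ) < B := by exact_mod_cast hB
  set K := max (2 * Real.exp (c + ω)) (B / ω) with hK
  have hK0 : 0 < K := lt_max_of_lt_left (by positivity)
  refine ⟨K, hK0, fun m => ?_⟩
  have h1 : (m : ℝ) / B ≤ (m / B : ℕ) + 1 := by
    rw [div_le_iff₀ hB']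
    have h2 : m < (m / B + 1) * B := by
      rw [add_mul, one_mul, mul_comm]; exact Nat.lt_mul_div_succ m hB |>.trans_eq (by ring)
    exact_mod_cast h2.le
  have h3 : (m : ℝ) / K ≤ ω * ((m / B : ℕ) + 1) := by
    calc (m : ℝ) / K ≤ m / (B / ω) := by
          have := le_max_right (2 * Real.exp (c + ω)) (B / ω)
          gcongr
      _ = ω * (m / B) := by field_simp
      _ ≤ _ := by gcongr
  calc 2 * Real.exp (c - ω * (m / B : ℕ)) ≤ 2 * Real.exp (c + ω + -m / K) := by
        gcongr
        rw [neg_div]; linarith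
    _ = 2 * Real.exp (c + ω) * Real.exp (-m / K) := by rw [Real.exp_add (c + ω)]; ring
    _ ≤ K * Real.exp (-m / K) := by gcongr; exact le_max_left _ _

variable [IsIsometricSMul G X]

/-- The key estimate: up to a factor close to `1`, the displacement of the random walk grows at
least like the sum of the rewards of its blocks, outside of an event with exponentially small
probability. -/
theorem IsNonElementary.exists_block_bound (hX : IsGeodesicSpace X) {o : X} {μ : Measure G}
    [IsProbabilityMeasure μ] (hμ : IsNonElementary o μ) {γ : ℝ} (hγ : 0 < γ) (hγ' : γ < 1) :
    ∃ (R : ℕ) (A : ℝ), 0 < R ∧ ∀ (N : ℕ) (T : ℝ) (r : G → ℝ), (∀ x, 0 ≤ r x) → (∀ x, r x ≤ T) →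
      (∀ g x u, dist o (g • o) ≤ A → dist o (u • o) ≤ A → r x ≤ 1 + dist o ((g * x * u) • o)) →
      ∀ L : ℝ, 0 ≤ L → L * (N + R) < (1 - γ) * ∫ x, r x ∂(convPow μ N) →
      ∃ K : ℝ, 0 < K ∧ ∀ m : ℕ, convPow μ m {g | dist o (g • o) ≤ L * m} ≤
        ENNReal.ofReal (K * Real.exp (-m / K)) := by
  obtain ⟨g, hg, h, hh, hgc, hhc, hind⟩ := hμ
  -- These values give `8 * η = κ ^ 2` and keep the total loss `2 * η + κ + 3 * δ` below `γ`.
  set κ := γ / 4 with hκ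
  set η := κ ^ 2 / 8 with hη
  set δ := γ / 12 with hδ
  have hκ0 : 0 < κ := by positivity
  have hη0 : 0 < η := by positivity
  obtain ⟨P, Q, a, b, ha, hb, left, right, hs⟩ := exists_isSchottky hX hgc hhc hind hη0
  obtain ⟨p, hp⟩ := exists_convPow_ne_zero μ (pow_mem hg P)
  obtain ⟨q, hq⟩ := exists_convPow_ne_zero μ hh
  have : NeZero a := ⟨ha.ne'⟩
  have : NeZero b := ⟨hb.ne'⟩
  obtain ⟨R, A, τ, ζ, hR, hτf, hζf, hζ, hτ, hd⟩ := exists_decomposition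
    (s := schottkyLetter (g ^ P) h Q a b) o μ _ (convPow_schottkyLetter_ne_zero μ hp hq Q a b)
    (δ := ENNReal.ofReal δ) (by simpa using by positivity)
  refine ⟨R, A, hR, fun N T r hr hrT hrg L hL hLN => ?_⟩
  obtain ⟨t, ε, ht, hε, hε', htε, hmom⟩ := exists_exp_moment_le hr hrT (sub_pos.2 hγ') hLN
  have hsum : 2 * η + κ + 3 * δ ≤ γ := by
    have : η ≤ κ / 8 := by rw [hη]; nlinarith
    rw [hδ]; linarith
  have hexp := fun m n => hs.expDisp_le ht.le hκ0 (by linarith) hη0.le (by rw [hη]; linarith)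
    (δ := δ) (by positivity) (by linarith) hε hε' hd hζ.le hτ hr hrg hmom m n 1
  set B := N + R with hB
  have hB0 : 0 < B := by omega
  have hBr : (B : ℝ) = N + R := by rw [hB]; push_cast; ring
  -- The decay rate per block: gain of the exponential moment minus the cost in Markov's inequality.
  set ω := (1 - γ) * ε - t * (L * (N + R)) with hω
  obtain ⟨K, hK, hKm⟩ := exists_exp_decay hB0 (ω := ω) (c := t * (L * (N + R))) (by linarith)
  refine ⟨K, hK, fun m => ?_⟩
  refine (measure_dist_le_expDisp o _ ht.le _).trans ?_
  have h1 := hexp (m % B) (m / B)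
  rw [mul_comm, Nat.div_add_mod] at h1
  calc _ ≤ ENNReal.ofReal (Real.exp (t * (L * m))) * _ := by gcongr
    _ = ENNReal.ofReal (Real.exp (t * (L * m)) *
        (2 * (1 - (1 - (2 * η + κ + 3 * δ)) * ε) ^ (m / B))) :=
      (ENNReal.ofReal_mul (Real.exp_pos _).le).symm
    _ ≤ ENNReal.ofReal (2 * Real.exp (t * (L * (N + R)) - ω * (m / B : ℕ))) := by
      refine ENNReal.ofReal_le_ofReal ?_
      have h2 : (m : ℝ) ≤ (N + R) * ((m / B : ℕ) + 1) := by
        rw [← hBr]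
        exact_mod_cast (Nat.lt_mul_div_succ m hB0).le
      have h3 : Real.exp (t * (L * m)) ≤
          Real.exp (t * (L * (N + R)) + t * (L * (N + R)) * (m / B : ℕ)) := by
        refine Real.exp_le_exp.2 ?_
        calc t * (L * m) ≤ t * (L * ((N + R) * ((m / B : ℕ) + 1))) := by gcongr
          _ = _ := by ring
      have h0 := contraction_factor_ge (δ := δ) hκ0 hη0.le (by positivity) hε
      have h4 : (1 - (1 - (2 * η + κ + 3 * δ)) * ε) ^ (m / B) ≤
          Real.exp (-((1 - γ) * ε) * (m / B : ℕ)) := by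
        rw [mul_comm (-((1 - γ) * ε)), Real.exp_nat_mul]
        refine pow_le_pow_left₀ (by linarith) ?_ _
        have h5 := Real.add_one_le_exp (-((1 - γ) * ε))
        nlinarith
      calc _ ≤ Real.exp (t * (L * (N + R)) + t * (L * (N + R)) * (m / B : ℕ)) *
            (2 * Real.exp (-((1 - γ) * ε) * (m / B : ℕ))) := by
            gcongr
            exact mul_nonneg zero_le_two (pow_nonneg (by linarith) _)
        _ = 2 * (Real.exp (t * (L * (N + R)) + t * (L * (N + R)) * (m / B : ℕ)) *
            Real.exp (-((1 - γ) * ε) * (m / B : ℕ))) := by ring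
        _ = _ := by
            rw [← Real.exp_add, hω]
            congr 2; ring
    _ ≤ _ := ENNReal.ofReal_le_ofReal (hKm m)

end ExponentialBound

/-! ### Laws and independence of segments of the walk -/

section WalkLaw

set_option linter.unusedSectionVars false

open ProbabilityTheory

variable {G : Type*} [Group G]

lemma walk_add (g : ℤ → G) (m n : ℕ) :
    walk g (m + n) = walk g m * walk (fun i => g (m + i)) n := by
  induction n with
  | zero => simp [walk]
  | succ n ih =>
    rw [← add_assoc, walk, ih, walk, mul_assoc]
    congr 3

lemma walk_congr {g g' : ℤ → G} {n : ℕ} (h : ∀ i ∈ Finset.Ioc (0 : ℤ) n, g i = g' i) :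
    walk g n = walk g' n := by
  induction n with
  | zero => rfl
  | succ n ih =>
    have h1 : walk g n = walk g' n := ih fun i hi => h i <| by
      simp only [Finset.mem_Ioc] at hi ⊢; push_cast; omega
    have h2 : g ((n : ℤ) + 1) = g' ((n : ℤ) + 1) := h _ <| by
      simp only [Finset.mem_Ioc]; push_cast; omega
    rw [walk, walk, h1, h2]

lemma dependsOn_walk_shift (a : ℤ) (n : ℕ) :
    DependsOn (fun g : ℤ → G => walk (fun i => g (a + i)) n) (Finset.Ioc a (a + n) : Finset ℤ) := by
  intro g g' h
  refine walk_congr fun i hi => h _ ?_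
  simp only [Finset.mem_Ioc, Finset.coe_Ioc, Set.mem_Ioc] at hi ⊢
  omega

variable [Countable G] [MeasurableSpace G] [DiscreteMeasurableSpace G]

lemma measurable_walk_shift (a : ℤ) (n : ℕ) :
    Measurable fun g : ℤ → G => walk (fun i => g (a + i)) n := by
  induction n with
  | zero => exact measurable_const
  | succ n ih => exact ih.mul (measurable_pi_apply _)

lemma measurable_walk (n : ℕ) : Measurable fun g : ℤ → G => walk g n := by
  simpa using measurable_walk_shift (G := G) 0 n

variable (μ : Measure G) [IsProbabilityMeasure μ]

instance : IsProbabilityMeasure (stepMeasure μ) := by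
  unfold stepMeasure; infer_instance

/-- Each function factors through the restriction to its finite set of indices, by filling the other
coordinates with `1`. -/
lemma indepFun_stepMeasure_of_dependsOn {α β : Type*} [MeasurableSpace α] [MeasurableSpace β]
    {F : (ℤ → G) → α} {F' : (ℤ → G) → β} {S T : Finset ℤ} (hF : Measurable F)
    (hF' : Measurable F') (hFS : DependsOn F (S : Set ℤ)) (hFT : DependsOn F' (T : Set ℤ))
    (hST : Disjoint S T) : IndepFun F F' (stepMeasure μ) := by
  classical
  have h := iIndepFun_infinitePi (P := fun _ : ℤ => μ) (X := fun _ x => x)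
    (fun _ => measurable_id)
  have h1 := h.indepFun_finset S T hST (fun i => measurable_pi_apply i)
  let ext (S : Finset ℤ) (v : S → G) (i : ℤ) : G := if hi : i ∈ S then v ⟨i, hi⟩ else 1
  have hext : ∀ S, Measurable (ext S) := fun S => by
    refine measurable_pi_iff.2 fun i => ?_
    by_cases hi : i ∈ S
    · simpa [ext, hi] using measurable_pi_apply _
    · simp [ext, hi]
  have h2 := h1.comp (hF.comp (hext S)) (hF'.comp (hext T))
  have e1 : F = (F ∘ ext S) ∘ fun g i => g i := by
    funext g
    exact hFS fun i hi => by simp [ext, Finset.mem_coe.1 hi]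
  have e2 : F' = (F' ∘ ext T) ∘ fun g i => g i := by
    funext g
    exact hFT fun i hi => by simp [ext, Finset.mem_coe.1 hi]
  rw [e1, e2]
  exact h2

/-- The law of a segment of the random walk. -/
lemma map_walk_shift (a : ℤ) (n : ℕ) :
    (stepMeasure μ).map (fun g => walk (fun i => g (a + i)) n) = convPow μ n := by
  induction n with
  | zero => simp [walk, convPow, Measure.map_const]
  | succ n ih =>
    have h1 : IndepFun (fun g : ℤ → G => walk (fun i => g (a + i)) n)
        (fun g => g (a + ((n : ℤ) + 1))) (stepMeasure μ) := by
      refine indepFun_stepMeasure_of_dependsOn μ (S := Finset.Ioc a (a + n))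
        (T := {a + ((n : ℤ) + 1)}) (measurable_walk_shift a n) (measurable_pi_apply _)
        (dependsOn_walk_shift a n) (fun g g' h => h _ (by simp)) ?_
      simp
    have h2 := h1.map_mul_eq_map_mconv_map (measurable_walk_shift a n) (measurable_pi_apply _)
    have h3 : (stepMeasure μ).map (fun g => g (a + ((n : ℤ) + 1))) = μ :=
      Measure.infinitePi_map_eval (fun _ : ℤ => μ) _
    rw [ih, h3] at h2
    rw [convPow, ← h2]
    rfl

lemma map_walk (n : ℕ) : (stepMeasure μ).map (fun g => walk g n) = convPow μ n := by
  simpa using map_walk_shift μ 0 n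

end WalkLaw

/-! ### The speed and the almost sure upper bound -/

section Speed

set_option linter.unusedSectionVars false

variable {X G : Type*} [MetricSpace X] [Group G] [MulAction G X] [IsIsometricSMul G X]
  [Countable G] [MeasurableSpace G] [DiscreteMeasurableSpace G]

/-- The expected displacement. -/
noncomputable def meanDisp (o : X) (ν : Measure G) : ℝ≥0∞ :=
  ∫⁻ g, ENNReal.ofReal (dist o (g • o)) ∂ν

lemma dist_smul_mul_le (o : X) (g h : G) :
    dist o ((g * h) • o) ≤ dist o (g • o) + dist o (h • o) := by
  calc dist o ((g * h) • o) ≤ dist o (g • o) + dist (g • o) ((g * h) • o) := dist_triangle _ _ _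
    _ = _ := by rw [mul_smul, dist_smul]

variable (o : X) (μ : Measure G) [IsProbabilityMeasure μ]

lemma meanDisp_convPow_add_le (m n : ℕ) :
    meanDisp o (convPow μ (m + n)) ≤ meanDisp o (convPow μ m) + meanDisp o (convPow μ n) := by
  rw [meanDisp, lintegral_convPow_add]
  calc _ ≤ ∫⁻ x, ∫⁻ y, (ENNReal.ofReal (dist o (x • o)) + ENNReal.ofReal (dist o (y • o)))
        ∂convPow μ n ∂convPow μ m := by
        refine lintegral_mono fun x => lintegral_mono fun y => ?_
        rw [← ENNReal.ofReal_add dist_nonneg dist_nonneg]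
        exact ENNReal.ofReal_le_ofReal (dist_smul_mul_le o x y)
    _ = _ := by
        simp only [lintegral_add_left (Measurable.of_discrete : Measurable fun _ : G => _),
          lintegral_const, measure_univ, mul_one, meanDisp]

lemma meanDisp_convPow_mul_le (k N : ℕ) :
    meanDisp o (convPow μ (k * N)) ≤ k * meanDisp o (convPow μ N) := by
  induction k with
  | zero => simp [convPow, meanDisp]
  | succ k ih =>
    rw [add_mul, one_mul]
    refine (meanDisp_convPow_add_le o μ _ _).trans ?_
    push_cast
    rw [add_mul, one_mul]
    gcongr

/-- The escape rate, as the infimum of the normalized expected displacements. -/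
noncomputable def speed : ℝ≥0∞ :=
  ⨅ N : ℕ, meanDisp o (convPow μ (N + 1)) / ((N : ℝ≥0∞) + 1)

lemma speed_mul_le (N : ℕ) : speed o μ * N ≤ meanDisp o (convPow μ N) := by
  rcases N with _ | N
  · simp
  · have h : speed o μ ≤ meanDisp o (convPow μ (N + 1)) / ((N : ℝ≥0∞) + 1) := iInf_le _ N
    rw [ENNReal.le_div_iff_mul_le (by simp) (by simp)] at h
    exact_mod_cast h

open ProbabilityTheory in
/-- The speed is an almost sure upper bound for the asymptotic displacement. -/
lemma ae_eventually_dist_walk_lt {q : ℝ} (hq : speed o μ < ENNReal.ofReal q) :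
    ∀ᵐ g ∂stepMeasure μ, ∀ᶠ n : ℕ in atTop, dist o (walk g n • o) / n < q := by
  obtain ⟨N', hN'⟩ := iInf_lt_iff.1 hq
  set N := N' + 1 with hN
  have hN0 : (0 : ℝ) < N := by positivity
  have hq0 : 0 < q := ENNReal.ofReal_pos.1 (pos_of_gt hq)
  set ρ : G → ℝ := fun x => dist o (x • o) with hρ
  have hE : meanDisp o (convPow μ N) < ENNReal.ofReal (q * N) := by
    rw [ENNReal.div_lt_iff (by simp) (by simp)] at hN'
    rw [ENNReal.ofReal_mul hq0.le, ENNReal.ofReal_natCast, hN]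
    exact_mod_cast hN'
  have hint : Integrable ρ (convPow μ N) := by
    refine ⟨Measurable.of_discrete.aestronglyMeasurable, ?_⟩
    rw [hasFiniteIntegral_iff_ofReal (Eventually.of_forall fun _ => dist_nonneg)]
    exact hE.trans_le le_top
  set e := ∫ x, ρ x ∂convPow μ N with he
  have heq : e < q * N := by
    rw [he, integral_eq_lintegral_of_nonneg_ae (Eventually.of_forall fun _ => dist_nonneg)
      Measurable.of_discrete.aestronglyMeasurable]
    exact ENNReal.toReal_lt_of_lt_ofReal hE
  -- Displacements of the consecutive blocks of `N` steps after time `r`. The strong law is used for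
  -- each residue `r` modulo `N`, so every time is reached without controlling partial blocks.
  let Y (r j : ℕ) (g : ℤ → G) : ℝ := ρ (walk (fun i => g (((r + j * N : ℕ) : ℤ) + i)) N)
  have hY : ∀ r j, Measurable (Y r j) := fun r j =>
    (Measurable.of_discrete (f := ρ)).comp (measurable_walk_shift _ N)
  have hlaw : ∀ r, ∀ᵐ g ∂stepMeasure μ,
      Tendsto (fun k : ℕ => (∑ j ∈ Finset.range k, Y r j g) / k) atTop (𝓝 e) := by
    intro r
    have hid : ∀ j, IdentDistrib (Y r j) (Y r 0) (stepMeasure μ) (stepMeasure μ) := fun j => by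
      have : IdentDistrib (fun g : ℤ → G => walk (fun i => g (((r + j * N : ℕ) : ℤ) + i)) N)
          (fun g : ℤ → G => walk (fun i => g (((r + 0 * N : ℕ) : ℤ) + i)) N)
          (stepMeasure μ) (stepMeasure μ) :=
        ⟨(measurable_walk_shift _ N).aemeasurable, (measurable_walk_shift _ N).aemeasurable, by
          rw [map_walk_shift, map_walk_shift]⟩
      exact this.comp (Measurable.of_discrete (f := ρ))
    have hint0 : Integrable (Y r 0) (stepMeasure μ) := by
      have h1 := hint
      rw [← map_walk_shift μ ((r + 0 * N : ℕ) : ℤ) N] at h1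
      exact h1.comp_measurable (measurable_walk_shift _ N)
    have hind : Pairwise (Function.onFun (fun f g => IndepFun f g (stepMeasure μ)) (Y r)) := by
      intro j k hjk
      have hd : ∀ j, DependsOn (Y r j)
          (Finset.Ioc ((r + j * N : ℕ) : ℤ) ((r + j * N : ℕ) + N) : Finset ℤ) := fun j g g' h =>
        congrArg ρ (dependsOn_walk_shift _ N h)
      refine indepFun_stepMeasure_of_dependsOn μ (hY r j) (hY r k) (hd j) (hd k) ?_
      rw [Finset.disjoint_left]
      intro i hi hi'
      simp only [Finset.mem_Ioc] at hi hi'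
      rcases lt_or_gt_of_ne hjk with h | h
      · have := Nat.mul_le_mul_right N (Nat.succ_le_of_lt h)
        rw [Nat.succ_mul] at this
        push_cast at hi hi'
        zify at this
        omega
      · have := Nat.mul_le_mul_right N (Nat.succ_le_of_lt h)
        rw [Nat.succ_mul] at this
        push_cast at hi hi'
        zify at this
        omega
    have hmean : ∫ g, Y r 0 g ∂stepMeasure μ = e := by
      rw [he, ← map_walk_shift μ ((r + 0 * N : ℕ) : ℤ) N, integral_map
        (measurable_walk_shift _ N).aemeasurable Measurable.of_discrete.aestronglyMeasurable]
    rw [← hmean]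
    exact strong_law_ae_real (Y r) hint0 hind hid
  have hbound : ∀ (g : ℤ → G) (r k : ℕ),
      ρ (walk g (r + k * N)) ≤ ρ (walk g r) + ∑ j ∈ Finset.range k, Y r j g := by
    intro g r k
    induction k with
    | zero => simp
    | succ k ih =>
      rw [add_mul, one_mul, ← add_assoc, walk_add, Finset.sum_range_succ, ← add_assoc]
      exact (dist_smul_mul_le o _ _).trans (by gcongr)
  filter_upwards [ae_all_iff.2 hlaw] with g hg
  have hr : ∀ r : ℕ, ∀ᶠ k : ℕ in atTop, ρ (walk g (r + k * N)) < q * (r + k * N) := by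
    intro r
    have h1 : Tendsto (fun k : ℕ => ρ (walk g r) / k +
        (∑ j ∈ Finset.range k, Y r j g) / k) atTop (𝓝 (0 + e)) :=
      (tendsto_const_div_atTop_nhds_zero_nat _).add (hg r)
    rw [zero_add] at h1
    filter_upwards [h1.eventually (gt_mem_nhds heq), eventually_gt_atTop 0] with k hk hk0
    have hk0' : (0 : ℝ) < k := by exact_mod_cast hk0
    rw [← add_div, div_lt_iff₀ hk0'] at hk
    calc _ ≤ _ := hbound g r k
      _ < q * N * k := hk
      _ ≤ q * (r + k * N) := by nlinarith [(Nat.cast_nonneg r : (0 : ℝ) ≤ r)]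
  have hall : ∀ᶠ k : ℕ in atTop, ∀ r ∈ Finset.range N,
      ρ (walk g (r + k * N)) < q * (r + k * N) :=
    (Finset.eventually_all _).2 fun r _ => hr r
  have hdiv : Tendsto (fun n : ℕ => n / N) atTop atTop :=
    Nat.tendsto_div_const_atTop (by omega)
  filter_upwards [hdiv.eventually hall, eventually_gt_atTop 0] with n hn hn0
  have h1 := hn (n % N) (Finset.mem_range.2 (Nat.mod_lt _ (by omega)))
  have h2 : n % N + n / N * N = n := by rw [mul_comm]; exact Nat.mod_add_div n N
  have h3 : ((n % N : ℕ) : ℝ) + (n / N : ℕ) * N = n := by exact_mod_cast h2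
  rw [h2, h3] at h1
  rw [div_lt_iff₀ (by exact_mod_cast hn0)]
  exact h1

end Speed

/-! ### Positivity of the speed, the exponential bound and the escape rate -/

section EscapeRate

set_option linter.unusedSectionVars false

variable {X G : Type*} [MetricSpace X] [Group G] [MulAction G X] [IsIsometricSMul G X]
  [Countable G] [MeasurableSpace G] [DiscreteMeasurableSpace G]
  {o : X} {μ : Measure G} [IsProbabilityMeasure μ]

lemma tendsto_const_mul_exp_neg_div {K : ℝ} (hK : 0 < K) :
    Tendsto (fun m : ℕ => K * Real.exp (-m / K)) atTop (𝓝 0) := by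
  have h1 : Tendsto (fun m : ℕ => (m : ℝ) / K) atTop atTop :=
    tendsto_natCast_atTop_atTop.atTop_div_const hK
  have h2 := (Real.tendsto_exp_neg_atTop_nhds_zero.comp h1).const_mul K
  simpa [Function.comp_def, neg_div] using h2

lemma summable_const_mul_exp_neg_div {K : ℝ} (hK : 0 < K) :
    Summable (fun m : ℕ => K * Real.exp (-m / K)) := by
  have h : ∀ m : ℕ, Real.exp (-m / K) = Real.exp (m * (-1 / K)) := fun m => by
    congr 1; ring
  simp only [h]
  exact (Real.summable_exp_nat_mul_iff.2 (div_neg_of_neg_of_pos (by norm_num) hK)).mul_left K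

/-- Subadditivity along multiples of `N + 1` transfers the bound from large times to all times. -/
lemma speed_pos_of_linear_bound {L : ℝ} (hL : 0 < L) {m₀ : ℕ}
    (h : ∀ m ≥ m₀, ENNReal.ofReal (L * m) ≤ meanDisp o (convPow μ m)) : 0 < speed o μ := by
  refine (ENNReal.ofReal_pos.2 hL).trans_le (le_iInf fun N => ?_)
  rw [ENNReal.le_div_iff_mul_le (by simp) (by simp)]
  have h1 := (h ((m₀ + 1) * (N + 1)) (by nlinarith)).trans
    (meanDisp_convPow_mul_le o μ (m₀ + 1) (N + 1))
  rw [ENNReal.ofReal_mul hL.le, ENNReal.ofReal_natCast, Nat.cast_mul, mul_left_comm] at h1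
  have h2 := (ENNReal.mul_le_mul_iff_right (by simp) (by simp)).1 h1
  exact_mod_cast h2

/-- The speed of a non-elementary random walk is positive. -/
theorem IsNonElementary.speed_pos (hX : IsGeodesicSpace X) (hμ : IsNonElementary o μ) :
    0 < speed o μ := by
  obtain ⟨R, A, hR, h⟩ := hμ.exists_block_bound hX (γ := 1 / 2) (by norm_num) (by norm_num)
  have hR' : (0 : ℝ) < R := by exact_mod_cast hR
  set L : ℝ := 1 / (4 * R) with hL
  have hL0 : 0 < L := by positivity
  have hLR : L * ((0 : ℕ) + R) < (1 - 1 / 2) * ∫ _, 1 ∂convPow μ 0 := by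
    have : L * R = 1 / 4 := by rw [hL]; field_simp
    simp only [Nat.cast_zero, zero_add, this, integral_const, probReal_univ, smul_eq_mul]
    norm_num
  -- Blocks without free part: the unit counted in each gap is the reward.
  obtain ⟨K, hK, hKm⟩ := h 0 1 (fun _ => 1) (fun _ => zero_le_one) (fun _ => le_rfl)
    (fun g x u _ _ => by linarith [dist_nonneg (x := o) (y := (g * x * u) • o)]) L hL0.le hLR
  obtain ⟨m₀, hm₀⟩ := eventually_atTop.1
    ((tendsto_const_mul_exp_neg_div hK).eventually (ge_mem_nhds (show (0 : ℝ) < 1 / 2 by norm_num)))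
  refine speed_pos_of_linear_bound (L := L / 2) (by positivity) (m₀ := m₀) fun m hm => ?_
  have h1 : 1 / 2 ≤ convPow μ m {g | dist o (g • o) ≤ L * m}ᶜ := by
    rw [prob_compl_eq_one_sub MeasurableSet.of_discrete]
    refine ENNReal.le_sub_of_add_le_left (measure_ne_top _ _) ?_
    calc _ ≤ ENNReal.ofReal (1 / 2) + 1 / 2 := by
          gcongr; exact (hKm m).trans (ENNReal.ofReal_le_ofReal (hm₀ m hm))
      _ = 1 := by
          rw [ENNReal.ofReal_div_of_pos two_pos]
          simp [ENNReal.inv_two_add_inv_two]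
  calc ENNReal.ofReal (L / 2 * m) = ENNReal.ofReal (L * m) * (1 / 2) := by
        rw [show L / 2 * m = L * m * (1 / 2) by ring, ENNReal.ofReal_mul (by positivity),
          ENNReal.ofReal_div_of_pos two_pos]
        simp
    _ ≤ ENNReal.ofReal (L * m) * convPow μ m {g | dist o (g • o) ≤ L * m}ᶜ := by gcongr
    _ ≤ ENNReal.ofReal (L * m) *
        convPow μ m {g | ENNReal.ofReal (L * m) ≤ ENNReal.ofReal (dist o (g • o))} := by
        gcongr
        intro g hg
        exact ENNReal.ofReal_le_ofReal (not_le.1 (Set.mem_compl_iff _ _ |>.1 hg)).le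
    _ ≤ meanDisp o (convPow μ m) := mul_meas_ge_le_lintegral Measurable.of_discrete _

/-- Truncation of the displacement: its mean approaches the mean displacement. -/
lemma exists_truncation (ν : Measure G) [IsProbabilityMeasure ν] {a A : ℝ} (hA : 0 ≤ A)
    (ha : 0 ≤ a) (h : ENNReal.ofReal (a + A) < meanDisp o ν) :
    ∃ T : ℕ, a < ∫ x, min (T : ℝ) (max 0 (dist o (x • o) - A)) ∂ν := by
  set f : G → ℝ := fun x => max 0 (dist o (x • o) - A) with hf
  have hf0 : ∀ x, 0 ≤ f x := fun x => le_max_left _ _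
  have h1 : ENNReal.ofReal a < ∫⁻ x, ENNReal.ofReal (f x) ∂ν := by
    have h2 : meanDisp o ν ≤ ∫⁻ x, ENNReal.ofReal (f x) ∂ν + ENNReal.ofReal A := by
      calc meanDisp o ν ≤ ∫⁻ x, (ENNReal.ofReal (f x) + ENNReal.ofReal A) ∂ν := by
            refine lintegral_mono fun x => ?_
            rw [← ENNReal.ofReal_add (hf0 x) hA]
            refine ENNReal.ofReal_le_ofReal ?_
            have : dist o (x • o) - A ≤ f x := le_max_right _ _
            linarith
        _ = _ := by rw [lintegral_add_right _ measurable_const]; simp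
    have h3 := h.trans_le h2
    rw [ENNReal.ofReal_add ha hA] at h3
    exact lt_of_add_lt_add_right h3
  have h4 : Tendsto (fun T : ℕ => ∫⁻ x, ENNReal.ofReal (min (T : ℝ) (f x)) ∂ν) atTop
      (𝓝 (∫⁻ x, ENNReal.ofReal (f x) ∂ν)) := by
    refine lintegral_tendsto_of_tendsto_of_monotone (fun _ => Measurable.of_discrete.aemeasurable)
      (Eventually.of_forall fun x => ?_) (Eventually.of_forall fun x => ?_)
    · intro S T hST
      refine ENNReal.ofReal_le_ofReal (min_le_min_right _ ?_)
      exact_mod_cast hST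
    · refine tendsto_const_nhds.congr' ?_
      filter_upwards [eventually_ge_atTop ⌈f x⌉₊] with T hT
      rw [min_eq_right ((Nat.le_ceil _).trans (by exact_mod_cast hT))]
  obtain ⟨T, hT⟩ := (h4.eventually (lt_mem_nhds h1)).exists
  refine ⟨T, ?_⟩
  have h5 : ∀ x, 0 ≤ min (T : ℝ) (f x) := fun x => le_min (Nat.cast_nonneg _) (hf0 x)
  have h6 : Integrable (fun x => min (T : ℝ) (f x)) ν :=
    Integrable.of_bound Measurable.of_discrete.aestronglyMeasurable T
      (Eventually.of_forall fun x => by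
        rw [Real.norm_of_nonneg (h5 x)]; exact min_le_left _ _)
  rw [← ofReal_integral_eq_lintegral_ofReal h6 (Eventually.of_forall h5)] at hT
  exact (ENNReal.ofReal_lt_ofReal_iff_of_nonneg ha).1 hT

/-- Exponential bound from below for the displacement of a non-elementary random walk. -/
theorem IsNonElementary.exists_exp_bound (hX : IsGeodesicSpace X) (hμ : IsNonElementary o μ)
    {L : ℝ} (hL : 0 < L) (hLs : ENNReal.ofReal L < speed o μ) :
    ∃ K : ℝ, 0 < K ∧ ∀ m : ℕ, convPow μ m {g | dist o (g • o) ≤ L * m} ≤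
      ENNReal.ofReal (K * Real.exp (-m / K)) := by
  obtain ⟨L₂', h1, h2⟩ := ENNReal.lt_iff_exists_nnreal_btwn.1 hLs
  set L₂ : ℝ := (L₂' : ℝ)
  have hL₂ : L < L₂ := by
    rw [ENNReal.ofReal, ENNReal.coe_lt_coe] at h1
    exact Real.toNNReal_lt_iff_lt_coe hL.le |>.1 h1
  rw [← ENNReal.ofReal_coe_nnreal] at h2
  change ENNReal.ofReal L₂ < _ at h2
  obtain ⟨L₁, hL1, hL12⟩ := exists_between hL₂
  have hL₁0 : 0 < L₁ := hL.trans hL1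
  -- Chosen so that `(1 - γ) * L₁ = (L₁ + L) / 2`, halfway between `L` and `L₁`.
  set γ := (L₁ - L) / (2 * L₁) with hγ
  have hγ0 : 0 < γ := div_pos (by linarith) (by linarith)
  have hγ1 : γ < 1 := by rw [hγ, div_lt_one (by linarith)]; linarith
  obtain ⟨R, A, -, h⟩ := hμ.exists_block_bound hX hγ0 hγ1
  set A' := max A 0
  have hA' : 0 ≤ A' := le_max_right _ _
  -- `R` and `A` are already fixed, so a large `N` makes both the `R` extra steps and the loss `2 *
  -- A'` negligible.
  obtain ⟨N, hN1, hN2, hN3⟩ : ∃ N : ℕ, 0 < N ∧ L * R < (L₁ - L) / 2 * N ∧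
      2 * A' < (L₂ - L₁) * N := by
    have h3 : Tendsto (fun N : ℕ => (L₁ - L) / 2 * N) atTop atTop :=
      tendsto_natCast_atTop_atTop.const_mul_atTop (by linarith)
    have h4 : Tendsto (fun N : ℕ => (L₂ - L₁) * N) atTop atTop :=
      tendsto_natCast_atTop_atTop.const_mul_atTop (by linarith)
    exact ((eventually_gt_atTop 0).and ((h3.eventually_gt_atTop _).and
      (h4.eventually_gt_atTop _))).exists
  have hN0 : (0 : ℝ) < N := by exact_mod_cast hN1
  have hE : ENNReal.ofReal (L₁ * N + 2 * A') < meanDisp o (convPow μ N) := by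
    calc ENNReal.ofReal (L₁ * N + 2 * A') ≤ ENNReal.ofReal (L₂ * N) :=
          ENNReal.ofReal_le_ofReal (by linarith)
      _ = ENNReal.ofReal L₂ * N := by
          rw [ENNReal.ofReal_mul (by linarith), ENNReal.ofReal_natCast]
      _ < speed o μ * N := ENNReal.mul_lt_mul_left (by simpa using hN1.ne') (by simp) h2
      _ ≤ _ := speed_mul_le o μ N
  obtain ⟨T, hT⟩ := exists_truncation (convPow μ N) (by positivity) (by positivity) hE
  refine h N T (fun x => min (T : ℝ) (max 0 (dist o (x • o) - 2 * A')))
    (fun x => le_min (Nat.cast_nonneg _) (le_max_left _ _)) (fun x => min_le_left _ _)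
    ?_ L hL.le ?_
  · intro g x u hg hu
    refine (min_le_right _ _).trans (max_le (by positivity) ?_)
    have h3 : dist o (x • o) ≤ dist o (g • o) + dist o ((g * x * u) • o) + dist o (u • o) := by
      calc dist o (x • o) = dist (g • o) ((g * x) • o) := by rw [mul_smul, dist_smul]
        _ ≤ dist (g • o) o + dist o ((g * x * u) • o) + dist ((g * x * u) • o) ((g * x) • o) :=
          dist_triangle4 _ _ _ _
        _ = _ := by rw [mul_smul (g * x) u, dist_smul, dist_comm (g • o), dist_comm (u • o)]
    have h4 : A ≤ A' := le_max_left _ _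
    linarith
  · have h3 : (1 - γ) * L₁ = (L₁ + L) / 2 := by rw [hγ]; field_simp; ring
    calc L * (N + R) < (1 - γ) * (L₁ * N) := by rw [← mul_assoc, h3]; linarith
      _ ≤ _ := mul_le_mul_of_nonneg_left hT.le (by linarith)

variable (μ) in
lemma stepMeasure_dist_walk_le (L : ℝ) (n : ℕ) :
    stepMeasure μ {g | dist o (walk g n • o) ≤ L * n} =
      convPow μ n {g | dist o (g • o) ≤ L * n} := by
  rw [← map_walk, Measure.map_apply (measurable_walk n) MeasurableSet.of_discrete]
  rfl

/-- The displacement of a non-elementary random walk almost surely grows at the linear rate given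
by the speed. -/
theorem IsNonElementary.isEscapeRate_speed (hX : IsGeodesicSpace X) (hμ : IsNonElementary o μ) :
    IsEscapeRate o μ (speed o μ) := by
  -- Borel–Cantelli at rational levels, so that only countably many null sets are discarded.
  have hlow : ∀ q : ℚ, ∀ᵐ g ∂stepMeasure μ, 0 < (q : ℝ) → ENNReal.ofReal q < speed o μ →
      ∀ᶠ n : ℕ in atTop, (q : ℝ) < dist o (walk g n • o) / n := by
    intro q
    by_cases hq : 0 < (q : ℝ) ∧ ENNReal.ofReal q < speed o μ
    · obtain ⟨K, hK, hKm⟩ := hμ.exists_exp_bound hX hq.1 hq.2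
      have h1 : ∑' n : ℕ, stepMeasure μ {g | dist o (walk g n • o) ≤ (q : ℝ) * n} ≠ ⊤ := by
        refine ne_top_of_le_ne_top (summable_const_mul_exp_neg_div hK).tsum_ofReal_ne_top
          (ENNReal.tsum_le_tsum fun n => ?_)
        rw [stepMeasure_dist_walk_le]
        exact hKm n
      filter_upwards [ae_eventually_notMem h1] with g hg _ _
      filter_upwards [hg, eventually_gt_atTop 0] with n hn hn0
      rw [lt_div_iff₀ (by exact_mod_cast hn0)]
      exact not_le.1 hn
    · exact Eventually.of_forall fun g h1 h2 => absurd ⟨h1, h2⟩ hq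
  -- Vacuous when the speed is infinite.
  have hup : ∀ q : ℚ, ∀ᵐ g ∂stepMeasure μ, speed o μ < ENNReal.ofReal q →
      ∀ᶠ n : ℕ in atTop, dist o (walk g n • o) / n < (q : ℝ) := by
    intro q
    by_cases hq : speed o μ < ENNReal.ofReal q
    · filter_upwards [ae_eventually_dist_walk_lt o μ hq] with g hg _ using hg
    · exact Eventually.of_forall fun g h => absurd h hq
  filter_upwards [ae_all_iff.2 hlow, ae_all_iff.2 hup] with g h1 h2
  refine tendsto_order.2 ⟨fun a ha => ?_, fun a ha => ?_⟩
  · obtain ⟨q, hq0, hq, hq'⟩ := ENNReal.lt_iff_exists_rat_btwn.1 ha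
    have hqr : (0 : ℝ) < q := (Real.toNNReal_pos.1 (by exact_mod_cast (pos_of_gt hq)))
    filter_upwards [h1 q hqr hq'] with n hn
    exact hq.trans (ENNReal.ofReal_lt_ofReal_iff_of_nonneg hqr.le |>.2 hn)
  · obtain ⟨q, hq0, hq, hq'⟩ := ENNReal.lt_iff_exists_rat_btwn.1 ha
    filter_upwards [h2 q hq] with n hn
    exact (ENNReal.ofReal_le_ofReal hn.le).trans_lt hq'

end EscapeRate

theorem theorem1p5 {X G : Type*} [MetricSpace X] (hX : IsGeodesicSpace X)
    [Group G] [Countable G] [MulAction G X] [IsIsometricSMul G X]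
    [MeasurableSpace G] [DiscreteMeasurableSpace G]
    (o : X) (μ : Measure G) [IsProbabilityMeasure μ] (hμ : IsNonElementary o μ) :
    ∃ ℓ : ℝ≥0∞, 0 < ℓ ∧ IsEscapeRate o μ ℓ ∧
      ∀ L : ℝ, 0 < L → ENNReal.ofReal L < ℓ →
        ∃ K : ℝ, 0 < K ∧ ∀ n : ℕ,
          (stepMeasure μ).real {g | dist o (walk g n • o) ≤ L * n} ≤ K * Real.exp (-n / K) := by
  refine ⟨speed o μ, hμ.speed_pos hX, hμ.isEscapeRate_speed hX, fun L hL hLs => ?_⟩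
  obtain ⟨K, hK, hKm⟩ := hμ.exists_exp_bound hX hL hLs
  refine ⟨K, hK, fun n => ?_⟩
  rw [measureReal_def, stepMeasure_dist_walk_le]
  exact ENNReal.toReal_le_of_le_ofReal (by positivity) (hKm n)
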